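/- **Theorem (Stability of $\mathsf{TMCP}^{e}_{p}(K,N)$).** *Definitions.* A *Lorentzian pre-length space* $(X,\mathsf d,\ll,\leq,\tau)$ is a proper metric space $(X,\mathsf d)$ with a preorder $\leq$, a transitive relation $\ll$ contained in $\leq$, and a lower semicontinuous $\tau:X\times X\to[0,\infty]$ such that $\tau(x,y)+\tau(y,z)\leq\tau(x,z)$ whenever $x\leq y\leq z$, $\tau(x,y)=0$ if $x\not\leq y$, and $\tau(x,y)>0\Leftrightarrow x\ll y$. A *causal curve* is a non-constant, locally Lipschitz curve $\gamma:I\to X$ on an interval $I\subset\mathbb R$ with $\gamma_s\leq\gamma_t$ for all $s<t$ in $I$; for $I=[a,b]$ its $\tau$-length ${\rm L}_\tau(\gamma)$ is the infimum of $\sum_{i}\tau(\gamma_{t_i},\gamma_{t_{i+1}})$ over all partitions $a=t_0<\dots<t_n=b$. The space is *geodesic* if any two points $x\leq y$, $x\neq y$, are joined by a causal curve $\gamma$ from $x$ to $y$ with ${\rm L}_\tau(\gamma)=\tau(x,y)$; *locally causally closed* if every point has a neighbourhood $U$ such that $\{(x,y)\in\bar U\times\bar U: x\leq y\}$ is closed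 in $\bar U\times\bar U$; *$\mathcal K$-globally hyperbolic* if for every compact set $C$ the $\mathsf d$-lengths of the causal curves contained in $C$ are bounded, and $\{z:\exists x\in K_1,\ y\in K_2,\ x\leq z\leq y\}$ is compact for all compact $K_1,K_2\subset X$. A *measured* Lorentzian geodesic space carries in addition a Radon measure $\mathfrak m\ge 0$ (Borel, finite on compact sets) with ${\rm supp}\,\mathfrak m=X$. For Borel probability measures $\mu,\nu$ on $X$ let $\ell_p(\mu,\nu)=\sup_\pi\big(\int\tau^p\,d\pi\big)^{1/p}$, the supremum being over couplings $\pi$ of $\mu$ and $\nu$ with $\pi(\{x\leq y\})=1$ ($-\infty$ if there are none). An *$\ell_p$-geodesic* is a family $(\mu_t)_{t\in[0,1]}$ of Borel probability measures with $\ell_p(\mu_s,\mu_t)=(t-s)\,\ell_p(\mu_0,\mu_1)\in(0,\infty)$ for all $0\leq s<t\leq1$. Let ${\rm Ent}(\mu|\mathfrak m)=\int\rho\log\rho\,d\mathfrak m\in[-\infty,\infty)$ if $\mu=\rho\,\mathfrak m$ and $(\rho\log\rho)_+\in L^1(\mathfrak m)$, ${\rm Ent}(\mu|\mathfrak m)=+\infty$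 otherwise, and $U_N(\mu|\mathfrak m)=\exp(-{\rm Ent}(\mu|\mathfrak m)/N)$. For $t\in[0,1]$ and $\vartheta\ge0$ let $$\sigma^{(t)}_\kappa(\vartheta)=\begin{cases}\mathfrak s_\kappa(t\vartheta)/\mathfrak s_\kappa(\vartheta), & \kappa\vartheta^2\neq0,\ \kappa\vartheta^2<\pi^2,\\ t,&\kappa\vartheta^2=0,\\ +\infty,&\kappa\vartheta^2\geq\pi^2,\end{cases}$$ where $\mathfrak s_\kappa(\vartheta)=\sin(\sqrt\kappa\,\vartheta)/\sqrt\kappa$ for $\kappa>0$, $\mathfrak s_0(\vartheta)=\vartheta$, and $\mathfrak s_\kappa(\vartheta)=\sinh(\sqrt{-\kappa}\,\vartheta)/\sqrt{-\kappa}$ for $\kappa<0$. For $p\in(0,1)$, $K\in\mathbb R$, $N\in(0,\infty)$ the space satisfies $\mathsf{TMCP}^{e}_{p}(K,N)$ if for every compactly supported Borel probability measure $\mu_0$ with ${\rm Ent}(\mu_0|\mathfrak m)\in\mathbb R$ and every $x_1\in X$ with $x\ll x_1$ for $\mu_0$-a.e. $x$, there is an $\ell_p$-geodesic $(\mu_t)_{t\in[0,1]}$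 from $\mu_0$ to $\mu_1=\delta_{x_1}$ with $$U_N(\mu_t|\mathfrak m)\ \geq\ \sigma^{(1-t)}_{K/N}\big(\|\tau(\cdot,x_1)\|_{L^2(\mu_0)}\big)\,U_N(\mu_0|\mathfrak m)\qquad\forall t\in[0,1).$$ *Statement.* Let $(X_j,\mathsf d_j,\mathfrak m_j,\ll_j,\leq_j,\tau_j)$, $j\in\mathbb N\cup\{\infty\}$, be measured Lorentzian geodesic spaces such that: 1. there are a locally causally closed, $\mathcal K$-globally hyperbolic Lorentzian geodesic space $(\bar X,\bar{\mathsf d},\bar\ll,\bar\leq,\bar\tau)$, whose time separation $\bar\tau$ is finite and continuous, and topological embeddings $\iota_j:X_j\to\bar X$, $j\in\mathbb N\cup\{\infty\}$, with $x\leq_j y\Leftrightarrow\iota_j(x)\,\bar\leq\,\iota_j(y)$ and $\bar\tau(\iota_j(x),\iota_j(y))=\tau_j(x,y)$ for all $x,y\in X_j$; 2. every $\varphi\in C_c(\bar X)$ is integrable with respect to every $(\iota_j)_\sharp\mathfrak m_j$, $j\in\mathbb N\cup\{\infty\}$, and $\int\varphi\,d(\iota_j)_\sharp\mathfrak m_j\to\int\varphi\,d(\iota_\infty)_\sharp\mathfrak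 m_\infty$ as $j\to\infty$; 3. there are $p\in(0,1)$, $K\in\mathbb R$, $N\in(0,\infty)$ such that $X_j$ satisfies $\mathsf{TMCP}^{e}_{p}(K,N)$ for every $j\in\mathbb N$. Then $X_\infty$ satisfies $\mathsf{TMCP}^{e}_{p}(K,N)$ as well. -/

import Mathlib

open MeasureTheory Set Filter Topology
open scoped ENNReal NNReal

noncomputable section

namespace Lorentz

/-! ## Causal spaces and Lorentzian pre-length spaces -/

/-- A causal space: a preorder `causal` (written `x ≤ y` on paper) and a transitive relation
`chron` (written `x ≪ y` on paper) contained in it. -/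
class CausalSpace (X : Type*) where
  causal : X → X → Prop
  chron : X → X → Prop
  causal_refl : ∀ x, causal x x
  causal_trans : ∀ x y z, causal x y → causal y z → causal x z
  chron_trans : ∀ x y z, chron x y → chron y z → chron x z
  causal_of_chron : ∀ x y, chron x y → causal x y

/-- A Lorentzian pre-length space: a causal space with a proper metric and a lower semicontinuous
time separation function `tau : X × X → [0, ∞]`. -/
class LorentzianPreLengthSpace (X : Type*) [MetricSpace X] extends
    ProperSpace X, CausalSpace X where
  tau : X → X → ℝ≥0∞
  lowerSemicontinuous_tau : LowerSemicontinuous fun z : X × X => tau z.1 z.2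
  reverse_triangle : ∀ x y z, causal x y → causal y z → tau x y + tau y z ≤ tau x z
  tau_eq_zero : ∀ x y, ¬ causal x y → tau x y = 0
  tau_pos_iff : ∀ x y, 0 < tau x y ↔ chron x y

open CausalSpace LorentzianPreLengthSpace

section Causality

variable (X : Type*) [MetricSpace X] [LorentzianPreLengthSpace X]

/-- Every point has a neighbourhood `U` such that `{x ≤ y}` is closed in `closure U × closure U`
(equivalently in `X × X`, since `closure U × closure U` is closed). -/
def LocallyCausallyClosed : Prop :=
  ∀ x : X, ∃ U ∈ 𝓝 x,
    IsClosed {z : X × X | causal z.1 z.2 ∧ z.1 ∈ closure U ∧ z.2 ∈ closure U}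

variable {X}

/-- The causal future of a set. -/
def causalFuture (A : Set X) : Set X := {y | ∃ x ∈ A, causal x y}

/-- The causal past of a set. -/
def causalPast (A : Set X) : Set X := {y | ∃ x ∈ A, causal y x}

/-- A (future directed) causal curve defined on the interval `I`: non-constant, locally Lipschitz
and monotone for the causal relation. -/
structure IsCausalCurve (γ : ℝ → X) (I : Set ℝ) : Prop where
  interval : I.OrdConnected
  nonconstant : ∃ s ∈ I, ∃ t ∈ I, γ s ≠ γ t
  locallyLipschitz : LocallyLipschitzOn I γ
  monotone : ∀ s ∈ I, ∀ t ∈ I, s < t → causal (γ s) (γ t)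

/-- The `τ`-length of a curve on `[a, b]`: the infimum of `∑ τ (γ (t i)) (γ (t (i + 1)))` over the
partitions `a = t 0 < t 1 < ... < t n = b`. -/
def tauLength (γ : ℝ → X) (a b : ℝ) : ℝ≥0∞ :=
  ⨅ (n : ℕ) (t : ℕ → ℝ) (_ : t 0 = a ∧ t n = b ∧ ∀ i < n, t i < t (i + 1)),
    ∑ i ∈ Finset.range n, tau (γ (t i)) (γ (t (i + 1)))

variable (X)

/-- The `d`-arc-length of the causal curves contained in a given compact set is bounded. -/
def NonTotallyImprisoning : Prop :=
  ∀ C : Set X, IsCompact C → ∃ L : ℝ≥0, ∀ (γ : ℝ → X) (I : Set ℝ),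
    IsCausalCurve γ I → MapsTo γ I C → eVariationOn γ I ≤ L

/-- `𝒦`-global hyperbolicity. -/
structure KGloballyHyperbolic : Prop where
  nonTotallyImprisoning : NonTotallyImprisoning X
  isCompact_diamond : ∀ K₁ K₂ : Set X, IsCompact K₁ → IsCompact K₂ →
    IsCompact (causalFuture K₁ ∩ causalPast K₂)

/-- Any two distinct causally related points are joined by a maximal causal curve. (For `x = y`
a non-constant causal curve would be a closed causal loop, so that pair is not considered.) -/
def IsGeodesicSpace : Prop :=
  ∀ x y : X, causal x y → x ≠ y → ∃ (a b : ℝ) (γ : ℝ → X), a < b ∧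
    IsCausalCurve γ (Icc a b) ∧ γ a = x ∧ γ b = y ∧ tauLength γ a b = tau x y

end Causality

/-! ## Reference measures, entropy, optimal transport -/

section Transport

variable {X : Type*} [MeasurableSpace X]

/-- `m` makes `X` a measured space: a Radon measure (a Borel measure finite on compact sets) with
full support. -/
structure IsReferenceMeasure [TopologicalSpace X] (m : Measure X) : Prop where
  lt_top_of_isCompact : ∀ C : Set X, IsCompact C → m C < ∞
  support_eq : m.support = univ

/-- The density `ρ` of `μ` with respect to `m`. -/
def density (μ m : Measure X) (x : X) : ℝ := (μ.rnDeriv m x).toReal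

open Classical in
/-- Relative entropy `Ent(μ | m) = ∫ ρ log ρ dm ∈ [-∞, ∞]` if `μ = ρ m` is absolutely continuous
and `(ρ log ρ)₊` is integrable; `+∞` otherwise. -/
def entropy (μ m : Measure X) : EReal :=
  if μ.AbsolutelyContinuous m ∧
      ∫⁻ x, ENNReal.ofReal (density μ m x * Real.log (density μ m x)) ∂m < ∞ then
    ((∫⁻ x, ENNReal.ofReal (density μ m x * Real.log (density μ m x)) ∂m : ℝ≥0∞) : EReal) -
      ((∫⁻ x, ENNReal.ofReal (-(density μ m x * Real.log (density μ m x))) ∂m : ℝ≥0∞) : EReal)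
  else ⊤

/-- `U_N(μ | m) = exp (-Ent(μ | m) / N) ∈ [0, ∞]`. -/
def entropicU (N : ℝ) (μ m : Measure X) : ℝ≥0∞ := EReal.exp (-(entropy μ m) / (N : EReal))

variable [MetricSpace X] [LorentzianPreLengthSpace X]

/-- `π ∈ Π_≤(μ, ν)`: a causal coupling of `μ` and `ν`. -/
structure IsCausalCoupling (π : Measure (X × X)) (μ ν : Measure X) : Prop where
  map_fst : π.map Prod.fst = μ
  map_snd : π.map Prod.snd = ν
  ae_causal : ∀ᵐ z ∂π, causal z.1 z.2

/-- The `p`-Lorentz-Wasserstein distance, with value `-∞` (the supremum of the empty set in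
`EReal`) when there is no causal coupling. -/
def ellP (p : ℝ) (μ ν : Measure X) : EReal :=
  ⨆ (π : Measure (X × X)) (_ : IsCausalCoupling π μ ν),
    (((∫⁻ z, tau z.1 z.2 ^ p ∂π) ^ (1 / p) : ℝ≥0∞) : EReal)

/-- `ℓ_p`-geodesics of probability measures:
`ℓ_p(μ_s, μ_t) = (t - s) ℓ_p(μ_0, μ_1) ∈ (0, ∞)` for `0 ≤ s < t ≤ 1`. -/
def IsEllPGeodesic (p : ℝ) (μ : Icc (0 : ℝ) 1 → ProbabilityMeasure X) : Prop :=
  ∀ s t : Icc (0 : ℝ) 1, s < t →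
    ellP p (μ s : Measure X) (μ t) =
        (((t : ℝ) - (s : ℝ) : ℝ) : EReal) * ellP p (μ 0 : Measure X) (μ 1) ∧
      0 < ellP p (μ s : Measure X) (μ t) ∧ ellP p (μ s : Measure X) (μ t) < ⊤

end Transport

/-! ## Distortion coefficients and the timelike measure contraction property -/

/-- The generalized sine function `𝔰_κ`. -/
def genSin (κ θ : ℝ) : ℝ :=
  if 0 < κ then Real.sin (√κ * θ) / √κ
  else if κ = 0 then θ
  else Real.sinh (√(-κ) * θ) / √(-κ)

/-- The distortion coefficient `σ_κ^{(t)}(θ) ∈ [0, ∞]`. -/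
def distortion (κ t θ : ℝ) : ℝ≥0∞ :=
  if κ * θ ^ 2 = 0 then ENNReal.ofReal t
  else if κ * θ ^ 2 < Real.pi ^ 2 then ENNReal.ofReal (genSin κ (t * θ) / genSin κ θ)
  else ∞

section TMCP

variable {X : Type*} [MeasurableSpace X] [MetricSpace X] [LorentzianPreLengthSpace X]

/-- `‖τ(·, x₁)‖_{L²(μ)}` as a real number. It is finite whenever `τ` is finite and continuous and
`μ` is a probability measure with compact support. -/
def tauNorm (μ : Measure X) (x₁ : X) : ℝ := ((∫⁻ x, tau x x₁ ^ 2 ∂μ) ^ (1 / 2 : ℝ)).toReal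

/-- The timelike measure contraction property `TMCP^e_p(K, N)` of `(X, d, m, ≪, ≤, τ)`. -/
def TMCP (p K N : ℝ) (m : Measure X) : Prop :=
  ∀ μ₀ : ProbabilityMeasure X, IsCompact (μ₀ : Measure X).support →
    entropy (μ₀ : Measure X) m ≠ ⊤ → entropy (μ₀ : Measure X) m ≠ ⊥ →
    ∀ x₁ : X, (∀ᵐ x ∂(μ₀ : Measure X), chron x x₁) →
      ∃ μ : Icc (0 : ℝ) 1 → ProbabilityMeasure X,
        IsEllPGeodesic p μ ∧ μ 0 = μ₀ ∧ (μ 1 : Measure X) = Measure.dirac x₁ ∧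
        ∀ t : Icc (0 : ℝ) 1, t < 1 →
          distortion (K / N) (1 - t) (tauNorm (μ₀ : Measure X) x₁) * entropicU N μ₀ m ≤
            entropicU N (μ t : Measure X) m

end TMCP

/-! ## Embeddings and convergence -/

/-- An isomorphic embedding: a topological embedding preserving `≤` (in both directions)
and `τ`. -/
structure IsIsomorphicEmbedding {X Y : Type*} [MetricSpace X] [LorentzianPreLengthSpace X]
    [MetricSpace Y] [LorentzianPreLengthSpace Y] (ι : X → Y) : Prop where
  isEmbedding : IsEmbedding ι
  causal_iff : ∀ x y, causal x y ↔ causal (ι x) (ι y)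
  tau_eq : ∀ x y, tau (ι x) (ι y) = tau x y

/-- Weak convergence `m n → m ⊤` in duality with continuous functions of compact support; the
integrals are required to make sense, i.e. all measures integrate such functions. -/
def WeaklyConverges {Y : Type*} [TopologicalSpace Y] [MeasurableSpace Y]
    (m : ℕ∞ → Measure Y) : Prop :=
  ∀ φ : Y → ℝ, Continuous φ → HasCompactSupport φ →
    (∀ j, Integrable φ (m j)) ∧
      Tendsto (fun n : ℕ => ∫ y, φ y ∂(m n)) atTop (𝓝 (∫ y, φ y ∂(m ⊤)))

end Lorentz

end

open Lorentz

open MeasureTheory Set Filter Topology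
open scoped ENNReal NNReal
open Lorentz

set_option linter.unusedSectionVars false

/-! ## The causal relation under compactness of causal diamonds -/

section Order

open CausalSpace LorentzianPreLengthSpace

variable {Y : Type*} [MetricSpace Y] [LorentzianPreLengthSpace Y]

/-! Everything is pushed forward to the ambient space `Y`, where the reference measures `M n`
converge vaguely to `M'` and each is carried by the σ-compact range `S n` of an embedding. Let `ν`
be an initial measure of the limit space and `y` its target.

Recovery of the initial data (`mem_closure_admissibleSet`): after truncation and regularisation `ν`
has a continuous compactly supported density `f`, up to normalisation. The same `f` taken against `M
n` yields measures that converge to `ν` together with their entropies. Since `y` lies in the support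
of `M'`, there are targets in `S n` converging to `y`.

Compactness: the contraction geodesics given by the hypothesis live in one compact causal diamond.
Along an ultrafilter they therefore converge weakly at all times simultaneously.

The limit is a geodesic (`isEllPGeodesic_of_tendsto`): causality is closed and `τ` is continuous, so
almost optimal causal couplings pass to the limit and give `ℓ_p(μ_s, μ_t) ≥ (t - s) L`. Here `L` is
the distance from the initial measure to the Dirac mass, which is explicit because only one coupling
exists. A strict inequality would contradict the reverse triangle inequality for `ℓ_p`, obtained by
gluing and the reverse Minkowski inequality.

Entropy (`entReal_le_of_tendsto`): by duality the entropy is a supremum of expressions `∫ φ dν - ∫ χ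
exp (φ - 1) dM`, each continuous in the pair of measures, so it is jointly lower semicontinuous. The
distortion coefficients converge once the limit parameter is known to be subcritical
(`mul_sq_lt_of_tendsto`): near criticality the midpoint coefficient blows up, while the entropies in
the diamond are bounded below.

Finally, finite entropy gives absolute continuity with respect to `M'`. Hence the limit measures at
times before `1` are carried by the range of the limit embedding and can be pulled back, even if
this range is not closed. -/

theorem isClosed_causal
    (h : ∀ K₁ K₂ : Set Y, IsCompact K₁ → IsCompact K₂ →
      IsCompact (causalFuture K₁ ∩ causalPast K₂)) :
    IsClosed {z : Y × Y | causal z.1 z.2} := by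
  refine IsSeqClosed.isClosed fun z q hz hq => ?_
  have hx : Tendsto (fun n => (z n).1) atTop (𝓝 q.1) := (continuous_fst.tendsto q).comp hq
  have hy : Tendsto (fun n => (z n).2) atTop (𝓝 q.2) := (continuous_snd.tendsto q).comp hq
  by_contra hcon
  -- The diamond between the completed tails of the two sequences is closed and contains the tail of
  -- the first one, hence also its limit. So the limit lies below a late term of the second
  -- sequence, the alternative being the claim itself.
  have key : ∀ N, ∃ n, N ≤ n ∧ causal q.1 (z n).2 := by
    intro N
    have hx' := (tendsto_add_atTop_iff_nat N).2 hx
    have hy' := (tendsto_add_atTop_iff_nat N).2 hy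
    have hc := h _ _ hx'.isCompact_insert_range hy'.isCompact_insert_range
    have hmem : q.1 ∈ causalFuture (insert q.1 (range fun n => (z (n + N)).1)) ∩
        causalPast (insert q.2 (range fun n => (z (n + N)).2)) := by
      refine hc.isClosed.mem_of_tendsto hx' (Eventually.of_forall fun n => ⟨?_, ?_⟩)
      · exact ⟨_, mem_insert_of_mem _ ⟨n, rfl⟩, causal_refl _⟩
      · exact ⟨_, mem_insert_of_mem _ ⟨n, rfl⟩, hz _⟩
    obtain ⟨w, hw, hqw⟩ := hmem.2
    rcases hw with rfl | ⟨n, rfl⟩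
    · exact absurd hqw hcon
    · exact ⟨n + N, by omega, hqw⟩
  -- With the lower endpoint now fixed, the same argument is applied to the upper endpoint along a
  -- subsequence.
  obtain ⟨φ, hφ, hφ'⟩ := extraction_of_frequently_atTop (frequently_atTop.2 key)
  have hy' := hy.comp hφ.tendsto_atTop
  have hc := h {q.1} _ isCompact_singleton hy'.isCompact_insert_range
  have hmem : q.2 ∈ causalFuture {q.1} ∩
      causalPast (insert q.2 (range ((fun n => (z n).2) ∘ φ))) := by
    refine hc.isClosed.mem_of_tendsto hy' (Eventually.of_forall fun n => ⟨?_, ?_⟩)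
    · exact ⟨_, rfl, hφ' n⟩
    · exact ⟨_, mem_insert_of_mem _ ⟨n, rfl⟩, causal_refl _⟩
  obtain ⟨w, hw, hqw⟩ := hmem.1
  rw [mem_singleton_iff.1 hw] at hqw
  exact hcon hqw

theorem isClosed_causalFuture (hJ : IsClosed {z : Y × Y | causal z.1 z.2}) {C : Set Y}
    (hC : IsCompact C) : IsClosed (causalFuture C) := by
  have : causalFuture C = Prod.snd '' ({z : Y × Y | causal z.1 z.2} ∩ C ×ˢ univ) := by
    ext y
    constructor
    · rintro ⟨x, hx, hxy⟩
      exact ⟨(x, y), ⟨hxy, hx, mem_univ _⟩, rfl⟩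
    · rintro ⟨⟨x, y⟩, ⟨hxy, hx, -⟩, rfl⟩
      exact ⟨x, hx, hxy⟩
  rw [this]
  refine IsSeqClosed.isClosed fun y q hy hq => ?_
  choose z hz hzy using hy
  obtain ⟨x, hxC, φ, hφ, hx⟩ := hC.tendsto_subseq fun n => (hz n).2.1
  have hlim : Tendsto (fun n => z (φ n)) atTop (𝓝 (x, q)) := by
    refine Tendsto.prodMk_nhds hx ?_
    have := hq.comp hφ.tendsto_atTop
    simpa [Function.comp_def, hzy] using this
  exact ⟨(x, q), ⟨hJ.mem_of_tendsto hlim (Eventually.of_forall fun n => (hz _).1), hxC,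
    mem_univ _⟩, rfl⟩

theorem isClosed_causalPast (hJ : IsClosed {z : Y × Y | causal z.1 z.2}) {C : Set Y}
    (hC : IsCompact C) : IsClosed (causalPast C) := by
  have : causalPast C = Prod.fst '' ({z : Y × Y | causal z.1 z.2} ∩ univ ×ˢ C) := by
    ext y
    constructor
    · rintro ⟨x, hx, hxy⟩
      exact ⟨(y, x), ⟨hxy, mem_univ _, hx⟩, rfl⟩
    · rintro ⟨⟨x, y⟩, ⟨hxy, -, hx⟩, rfl⟩
      exact ⟨y, hx, hxy⟩
  rw [this]
  refine IsSeqClosed.isClosed fun y q hy hq => ?_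
  choose z hz hzy using hy
  obtain ⟨x, hxC, φ, hφ, hx⟩ := hC.tendsto_subseq fun n => (hz n).2.2
  have hlim : Tendsto (fun n => z (φ n)) atTop (𝓝 (q, x)) := by
    refine Tendsto.prodMk_nhds ?_ hx
    have := hq.comp hφ.tendsto_atTop
    simpa [Function.comp_def, hzy] using this
  exact ⟨(q, x), ⟨hJ.mem_of_tendsto hlim (Eventually.of_forall fun n => (hz _).1), mem_univ _,
    hxC⟩, rfl⟩

end Order

/-! ## Weak limits of measures with support in a fixed compact set -/

section WeakLimits

variable {Y : Type*} [MetricSpace Y] [MeasurableSpace Y] [BorelSpace Y]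

theorem measure_compl_eq_zero_of_tendsto {α : Type*} {l : Filter α} [l.NeBot]
    {ν : α → ProbabilityMeasure Y} {μ : ProbabilityMeasure Y} (h : Tendsto ν l (𝓝 μ))
    {F : Set Y} (hF : IsClosed F) (hν : ∀ᶠ a in l, (ν a : Measure Y) Fᶜ = 0) :
    (μ : Measure Y) Fᶜ = 0 := by
  have h1 := ProbabilityMeasure.le_liminf_measure_open_of_tendsto h hF.isOpen_compl
  have h2 : liminf (fun i => (ν i : Measure Y) Fᶜ) l = 0 := by
    rw [liminf_congr hν]
    exact liminf_const 0
  rw [h2] at h1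
  exact le_antisymm h1 bot_le

/-- Prokhorov's theorem for a family tight in the strongest sense: the probability measures without
mass outside `D` form a compact set. Ultrafilters replace subsequences so that uncountably many
families can be made to converge at once. -/
theorem exists_tendsto_of_ultrafilter {α : Type*} (u : Ultrafilter α)
    {ν : α → ProbabilityMeasure Y} {D : Set Y} (hD : IsCompact D)
    (hν : ∀ᶠ a in (u : Filter α), (ν a : Measure Y) Dᶜ = 0) :
    ∃ μ : ProbabilityMeasure Y, Tendsto ν u (𝓝 μ) := by
  have hc := isCompact_setOfPred_probabilityMeasure_mass_eq_compl_isCompact_le (E := Y)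
    (u := fun _ => 0) (K := fun _ => D) tendsto_const_nhds (fun _ => hD) (Or.inl inferInstance)
  have hle : (u.map ν : Filter (ProbabilityMeasure Y)) ≤
      𝓟 {μ : ProbabilityMeasure Y | ∀ n : ℕ, μ ((fun _ => D) n)ᶜ ≤ (fun _ => (0 : ℝ≥0)) n} := by
    rw [le_principal_iff]
    change _ ∈ Filter.map ν u
    rw [Filter.mem_map]
    filter_upwards [hν] with a ha n
    have : ν a Dᶜ = 0 := (ProbabilityMeasure.null_iff_toMeasure_null _ _).2 ha
    simp [this]
  obtain ⟨μ, -, hμ⟩ := hc.ultrafilter_le_nhds (u.map ν) hle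
  exact ⟨μ, hμ⟩

theorem tendsto_lintegral_of_continuousOn_compact {α : Type*} {l : Filter α} [l.NeBot]
    {ν : α → ProbabilityMeasure Y} {μ : ProbabilityMeasure Y} (h : Tendsto ν l (𝓝 μ))
    {D : Set Y} (hD : IsCompact D) (hν : ∀ᶠ a in l, (ν a : Measure Y) Dᶜ = 0)
    {f : Y → ℝ≥0} (hf : Continuous f) :
    Tendsto (fun a => ∫⁻ x, f x ∂(ν a : Measure Y)) l (𝓝 (∫⁻ x, f x ∂(μ : Measure Y))) := by
  have hμ := measure_compl_eq_zero_of_tendsto h hD.isClosed hν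
  obtain ⟨c, hc⟩ : ∃ c : ℝ≥0, ∀ x ∈ D, f x ≤ c := by
    obtain ⟨c, hc⟩ := (hD.image hf).bddAbove
    exact ⟨c, fun x hx => hc ⟨x, hx, rfl⟩⟩
  -- Truncating at a bound of `f` on `D` makes the integrand bounded without changing its integral
  -- against measures carried by `D`.
  let g : BoundedContinuousFunction Y ℝ≥0 :=
    BoundedContinuousFunction.mkOfBound ⟨fun x => min (f x) c, by fun_prop⟩ c (by
      intro x y
      rw [NNReal.dist_eq]
      have h1 : ((min (f x) c : ℝ≥0) : ℝ) ≤ c := by exact_mod_cast min_le_right _ _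
      have h2 : ((min (f y) c : ℝ≥0) : ℝ) ≤ c := by exact_mod_cast min_le_right _ _
      have h3 : (0 : ℝ) ≤ (min (f x) c : ℝ≥0) := NNReal.coe_nonneg _
      have h4 : (0 : ℝ) ≤ (min (f y) c : ℝ≥0) := NNReal.coe_nonneg _
      rw [abs_le]
      constructor <;> simp only [ContinuousMap.coe_mk] <;> linarith)
  have hg : ∀ κ : ProbabilityMeasure Y, (κ : Measure Y) Dᶜ = 0 →
      ∫⁻ x, g x ∂(κ : Measure Y) = ∫⁻ x, f x ∂(κ : Measure Y) := by
    intro κ hκ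
    refine lintegral_congr_ae ?_
    have : ∀ᵐ x ∂(κ : Measure Y), x ∈ D := by
      rw [ae_iff]; exact hκ
    filter_upwards [this] with x hx
    change ((min (f x) c : ℝ≥0) : ℝ≥0∞) = _
    rw [min_eq_left (hc x hx)]
  have := ProbabilityMeasure.tendsto_iff_forall_lintegral_tendsto.1 h g
  rw [hg μ hμ] at this
  refine this.congr' ?_
  filter_upwards [hν] with a ha using hg _ ha

end WeakLimits

/-! ## Optimal transport for the time separation -/

section Transport

open CausalSpace LorentzianPreLengthSpace

variable {Y : Type*} [MetricSpace Y] [MeasurableSpace Y] [BorelSpace Y]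
  [LorentzianPreLengthSpace Y]

/-- The transport cost of a coupling. -/
noncomputable def timeCost (p : ℝ) (π : Measure (Y × Y)) : ℝ≥0∞ := ∫⁻ z, tau z.1 z.2 ^ p ∂π

theorem le_ellP {p : ℝ} {π : Measure (Y × Y)} {μ ν : Measure Y} (h : IsCausalCoupling π μ ν) :
    ((timeCost p π ^ (1 / p) : ℝ≥0∞) : EReal) ≤ ellP p μ ν :=
  le_iSup₂ (f := fun (π : Measure (Y × Y)) (_ : IsCausalCoupling π μ ν) =>
    (((∫⁻ z, tau z.1 z.2 ^ p ∂π) ^ (1 / p) : ℝ≥0∞) : EReal)) π h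

theorem exists_coupling_of_lt_ellP {p : ℝ} {μ ν : Measure Y} {c : ℝ≥0∞}
    (h : (c : EReal) < ellP p μ ν) :
    ∃ π, IsCausalCoupling π μ ν ∧ c < timeCost p π ^ (1 / p) := by
  obtain ⟨π, h1⟩ := lt_iSup_iff.1 h
  obtain ⟨h2, h3⟩ := lt_iSup_iff.1 h1
  exact ⟨π, h2, by exact_mod_cast h3⟩

theorem isCausalCoupling_diag (hJ : IsClosed {z : Y × Y | causal z.1 z.2}) (μ : Measure Y) :
    IsCausalCoupling (μ.map fun x => (x, x)) μ μ where
  map_fst := by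
    rw [Measure.map_map measurable_fst (by fun_prop)]
    exact Measure.map_id
  map_snd := by
    rw [Measure.map_map measurable_snd (by fun_prop)]
    exact Measure.map_id
  ae_causal := (ae_map_iff (by fun_prop) hJ.measurableSet).2
    (Eventually.of_forall fun _ => causal_refl _)

theorem isCausalCoupling_dirac (hJ : IsClosed {z : Y × Y | causal z.1 z.2})
    {μ : Measure Y} [IsProbabilityMeasure μ] {y : Y} (h : ∀ᵐ x ∂μ, causal x y) :
    IsCausalCoupling (μ.map fun x => (x, y)) μ (Measure.dirac y) where
  map_fst := by
    rw [Measure.map_map measurable_fst (by fun_prop)]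
    exact Measure.map_id
  map_snd := by
    rw [Measure.map_map measurable_snd (by fun_prop)]
    simp [Function.comp_def]
  ae_causal := (ae_map_iff (by fun_prop) hJ.measurableSet).2 h

/-- Such a coupling is concentrated on `z.2 = y`, so its cost depends on the first marginal alone.
This makes `ℓ_p` towards a point mass an explicit integral. -/
theorem timeCost_of_snd_dirac (hτ : Continuous fun z : Y × Y => tau z.1 z.2) {p : ℝ}
    {π : Measure (Y × Y)} {μ : Measure Y} {y : Y}
    (h : IsCausalCoupling π μ (Measure.dirac y)) :
    timeCost p π = ∫⁻ x, tau x y ^ p ∂μ := by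
  have h1 : ∀ᵐ z ∂π, z.2 = y := by
    have : ∀ᵐ w ∂(π.map Prod.snd), w = y := by
      rw [h.map_snd, ae_dirac_iff (measurableSet_eq)]
    exact (ae_map_iff measurable_snd.aemeasurable measurableSet_eq).1 this
  have h2 : Measurable fun x => tau x y :=
    (hτ.comp (by fun_prop : Continuous fun x : Y => (x, y))).measurable
  rw [← h.map_fst, lintegral_map (h2.pow_const p) measurable_fst, timeCost]
  refine lintegral_congr_ae ?_
  filter_upwards [h1] with z hz
  rw [hz]

theorem ellP_dirac (hJ : IsClosed {z : Y × Y | causal z.1 z.2})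
    (hτ : Continuous fun z : Y × Y => tau z.1 z.2) {p : ℝ}
    {μ : Measure Y} [IsProbabilityMeasure μ] {y : Y} (h : ∀ᵐ x ∂μ, causal x y) :
    ellP p μ (Measure.dirac y) = (((∫⁻ x, tau x y ^ p ∂μ) ^ (1 / p) : ℝ≥0∞) : EReal) := by
  refine le_antisymm (iSup₂_le fun π hπ => ?_) ?_
  · rw [← timeCost_of_snd_dirac hτ hπ]
    rfl
  · rw [← timeCost_of_snd_dirac hτ (isCausalCoupling_dirac hJ h)]
    exact le_ellP (isCausalCoupling_dirac hJ h)

theorem Lorentz.IsCausalCoupling.isProbabilityMeasure {π : Measure (Y × Y)} {μ ν : Measure Y}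
    [hμ : IsProbabilityMeasure μ] (h : IsCausalCoupling π μ ν) : IsProbabilityMeasure π := by
  have : IsProbabilityMeasure (π.map Prod.fst) := by rw [h.map_fst]; exact hμ
  exact Measure.isProbabilityMeasure_of_map Prod.fst

theorem tendsto_timeCost (hτ : Continuous fun z : Y × Y => tau z.1 z.2)
    (hfin : ∀ x y : Y, tau x y ≠ ∞) {p : ℝ} (hp : 0 ≤ p) {α : Type*} {l : Filter α} [l.NeBot]
    {π : α → ProbabilityMeasure (Y × Y)} {π' : ProbabilityMeasure (Y × Y)}
    (hπ : Tendsto π l (𝓝 π')) {D : Set (Y × Y)} (hD : IsCompact D)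
    (hπD : ∀ᶠ a in l, (π a : Measure (Y × Y)) Dᶜ = 0) :
    Tendsto (fun a => timeCost p (π a : Measure (Y × Y))) l
      (𝓝 (timeCost p (π' : Measure (Y × Y)))) := by
  have hcont : Continuous fun z : Y × Y => (tau z.1 z.2).toNNReal ^ p := by
    refine (NNReal.continuous_rpow_const hp).comp ?_
    exact continuous_iff_continuousAt.2 fun z =>
      (ENNReal.tendsto_toNNReal (hfin _ _)).comp (hτ.tendsto z)
  have hcost : ∀ κ : Measure (Y × Y), timeCost p κ =
      ∫⁻ z, (((tau z.1 z.2).toNNReal ^ p : ℝ≥0) : ℝ≥0∞) ∂κ := by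
    intro κ
    refine lintegral_congr fun z => ?_
    rw [ENNReal.coe_rpow_of_nonneg _ hp, ENNReal.coe_toNNReal (hfin _ _)]
  simp only [hcost]
  exact tendsto_lintegral_of_continuousOn_compact hπ hD hπD hcont

/-- Causal couplings with large cost pass to weak limits in a compact set. -/
theorem exists_limit_coupling (hJ : IsClosed {z : Y × Y | causal z.1 z.2})
    (hτ : Continuous fun z : Y × Y => tau z.1 z.2) (hfin : ∀ x y : Y, tau x y ≠ ∞)
    {p : ℝ} (hp : 0 ≤ p) {α : Type*} (u : Ultrafilter α)
    {μ ν : α → ProbabilityMeasure Y} {μ' ν' : ProbabilityMeasure Y}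
    (hμ : Tendsto μ u (𝓝 μ')) (hν : Tendsto ν u (𝓝 ν')) {D : Set Y} (hD : IsCompact D)
    (hμD : ∀ᶠ a in (u : Filter α), (μ a : Measure Y) Dᶜ = 0)
    (hνD : ∀ᶠ a in (u : Filter α), (ν a : Measure Y) Dᶜ = 0)
    {b : α → ℝ≥0∞} {b' : ℝ≥0∞} (hb : Tendsto b u (𝓝 b'))
    (hπ : ∀ᶠ a in (u : Filter α), ∃ π : Measure (Y × Y),
      IsCausalCoupling π (μ a : Measure Y) (ν a) ∧ b a ≤ timeCost p π) :
    ∃ π : Measure (Y × Y), IsCausalCoupling π (μ' : Measure Y) ν' ∧ b' ≤ timeCost p π := by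
  have hex : ∀ a, ∃ π : ProbabilityMeasure (Y × Y), (∃ π : Measure (Y × Y),
      IsCausalCoupling π (μ a : Measure Y) (ν a) ∧ b a ≤ timeCost p π) →
      IsCausalCoupling (π : Measure (Y × Y)) (μ a : Measure Y) (ν a) ∧
        b a ≤ timeCost p (π : Measure (Y × Y)) := by
    intro a
    by_cases h : ∃ π : Measure (Y × Y),
      IsCausalCoupling π (μ a : Measure Y) (ν a) ∧ b a ≤ timeCost p π
    · obtain ⟨π, hπ⟩ := h
      exact ⟨⟨π, hπ.1.isProbabilityMeasure⟩, fun _ => hπ⟩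
    · exact ⟨(μ a).prod (ν a), fun h' => absurd h' h⟩
  choose π hπ' using hex
  have hgood := hπ.mono fun a ha => hπ' a ha
  have hDD := hD.prod hD
  have hsupp : ∀ᶠ a in (u : Filter α), (π a : Measure (Y × Y)) (D ×ˢ D)ᶜ = 0 := by
    filter_upwards [hgood, hμD, hνD] with a ha h1 h2
    have h3 : ∀ᵐ z ∂(π a : Measure (Y × Y)), z.1 ∈ D := by
      refine (ae_map_iff measurable_fst.aemeasurable hD.measurableSet).1 ?_
      rw [ha.1.map_fst]
      exact h1
    have h4 : ∀ᵐ z ∂(π a : Measure (Y × Y)), z.2 ∈ D := by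
      refine (ae_map_iff measurable_snd.aemeasurable hD.measurableSet).1 ?_
      rw [ha.1.map_snd]
      exact h2
    have h5 : ∀ᵐ z ∂(π a : Measure (Y × Y)), z ∈ D ×ˢ D := by
      filter_upwards [h3, h4] with z hz1 hz2 using ⟨hz1, hz2⟩
    exact h5
  obtain ⟨π', hlim⟩ := exists_tendsto_of_ultrafilter u hDD hsupp
  refine ⟨π', ⟨?_, ?_, ?_⟩, ?_⟩
  · have h1 := ((ProbabilityMeasure.continuous_map (continuous_fst (X := Y) (Y := Y))).tendsto
      π').comp hlim
    have h2 : Tendsto μ u (𝓝 (π'.map (continuous_fst (X := Y) (Y := Y)).measurable.aemeasurable)) := by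
      refine h1.congr' ?_
      filter_upwards [hgood] with a ha
      exact Subtype.ext ha.1.map_fst
    exact congrArg (fun κ : ProbabilityMeasure Y => (κ : Measure Y)) (tendsto_nhds_unique h2 hμ)
  · have h1 := ((ProbabilityMeasure.continuous_map (continuous_snd (X := Y) (Y := Y))).tendsto
      π').comp hlim
    have h2 : Tendsto ν u (𝓝 (π'.map (continuous_snd (X := Y) (Y := Y)).measurable.aemeasurable)) := by
      refine h1.congr' ?_
      filter_upwards [hgood] with a ha
      exact Subtype.ext ha.1.map_snd
    exact congrArg (fun κ : ProbabilityMeasure Y => (κ : Measure Y)) (tendsto_nhds_unique h2 hν)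
  -- Closedness of the causal relation is what lets causality of couplings survive the weak limit.
  · exact measure_compl_eq_zero_of_tendsto hlim hJ (hgood.mono fun a ha => ha.1.ae_causal)
  · refine le_of_tendsto_of_tendsto hb (tendsto_timeCost hτ hfin hp hlim hDD hsupp) ?_
    filter_upwards [hgood] with a ha using ha.2

open ProbabilityTheory in
/-- Gluing of two couplings along their common marginal. -/
theorem exists_gluing [StandardBorelSpace Y] {μ₁ μ₂ μ₃ : Measure Y} [IsProbabilityMeasure μ₁]
    [IsProbabilityMeasure μ₂] {π π' : Measure (Y × Y)} (h : IsCausalCoupling π μ₁ μ₂)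
    (h' : IsCausalCoupling π' μ₂ μ₃) :
    ∃ γ : Measure ((Y × Y) × Y), γ.map Prod.fst = π ∧ γ.map (fun w => (w.1.2, w.2)) = π' := by
  have := h.isProbabilityMeasure
  have := h'.isProbabilityMeasure
  have : Nonempty Y := by
    by_contra hne
    rw [not_nonempty_iff] at hne
    have := measure_univ (μ := μ₁)
    rw [univ_eq_empty_iff.2 hne] at this
    simp at this
  -- `π'` is disintegrated over its first coordinate, and the kernel is then run from the second
  -- coordinate of `π`.
  let κ := π'.condKernel
  have hπ' : π.map Prod.snd ⊗ₘ κ = π' := by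
    have h1 : π.map Prod.snd = π'.fst := by rw [h.map_snd, Measure.fst, h'.map_fst]
    rw [h1]
    exact π'.disintegrate κ
  refine ⟨π ⊗ₘ (κ.comap Prod.snd measurable_snd), ?_, ?_⟩
  · exact Measure.fst_compProd _ _
  · refine Measure.ext_of_lintegral _ fun f hf => ?_
    rw [lintegral_map hf (by fun_prop), ← hπ', Measure.lintegral_compProd (by fun_prop),
      Measure.lintegral_compProd hf, lintegral_map _ measurable_snd]
    · simp [Kernel.comap_apply]
    · exact hf.lintegral_kernel_prod_right'

end Transport

/-! ## The reverse Minkowski inequality -/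

section ReverseMinkowski

/-- Concavity of `r ↦ r ^ p` at the points `x / a` and `y / b` with weights `a` and `b`, since `a *
(x / a) ^ p = a ^ (1 - p) * x ^ p`. -/
theorem rpow_mul_add_rpow_mul_le {p a b : ℝ} (hp₀ : 0 < p) (hp₁ : p < 1) (ha : 0 < a) (hb : 0 < b)
    (hab : a + b = 1) (x y : ℝ≥0∞) :
    ENNReal.ofReal a ^ (1 - p) * x ^ p + ENNReal.ofReal b ^ (1 - p) * y ^ p ≤ (x + y) ^ p := by
  rcases eq_or_ne x ∞ with rfl | hx
  · simp [hp₀]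
  rcases eq_or_ne y ∞ with rfl | hy
  · simp [hp₀]
  lift x to ℝ≥0 using hx
  lift y to ℝ≥0 using hy
  have hc := Real.concaveOn_rpow hp₀.le hp₁.le
  have h1 := hc.2 (x := (x : ℝ) / a) (y := (y : ℝ) / b) (by simp; positivity)
    (by simp; positivity) ha.le hb.le hab
  simp only [smul_eq_mul] at h1
  rw [mul_div_cancel₀ _ ha.ne', mul_div_cancel₀ _ hb.ne'] at h1
  have e : ∀ c : ℝ, 0 < c → ∀ z : ℝ≥0, c * ((z : ℝ) / c) ^ p = c ^ (1 - p) * (z : ℝ) ^ p := by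
    intro c hc z
    rw [Real.div_rpow z.coe_nonneg hc.le, Real.rpow_sub hc, Real.rpow_one]
    ring
  rw [e a ha, e b hb] at h1
  have h2 := ENNReal.ofReal_le_ofReal h1
  rw [ENNReal.ofReal_add (by positivity) (by positivity), ENNReal.ofReal_mul (by positivity),
    ENNReal.ofReal_mul (by positivity), ← ENNReal.ofReal_rpow_of_pos ha,
    ← ENNReal.ofReal_rpow_of_pos hb, ← ENNReal.ofReal_rpow_of_nonneg x.coe_nonneg hp₀.le,
    ← ENNReal.ofReal_rpow_of_nonneg y.coe_nonneg hp₀.le,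
    ← ENNReal.ofReal_rpow_of_nonneg (by positivity) hp₀.le,
    ENNReal.ofReal_add x.coe_nonneg y.coe_nonneg] at h2
  simpa using h2

/-- The reverse Minkowski inequality for exponents in `(0, 1)`. -/
theorem lintegral_rpow_add_ge {Ω : Type*} [MeasurableSpace Ω] {μ : Measure Ω} {p : ℝ} (hp₀ : 0 < p)
    (hp₁ : p < 1) {f g : Ω → ℝ≥0∞} (hf : Measurable f) (hg : Measurable g) :
    (∫⁻ x, f x ^ p ∂μ) ^ (1 / p) + (∫⁻ x, g x ^ p ∂μ) ^ (1 / p) ≤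
      (∫⁻ x, (f x + g x) ^ p ∂μ) ^ (1 / p) := by
  have hp' : 0 < 1 / p := by positivity
  set A := (∫⁻ x, f x ^ p ∂μ) ^ (1 / p) with hA
  set B := (∫⁻ x, g x ^ p ∂μ) ^ (1 / p) with hB
  have hAB : ∀ I : ℝ≥0∞, (I ^ (1 / p)) ^ p = I := fun I => by
    rw [← ENNReal.rpow_mul, one_div_mul_cancel hp₀.ne', ENNReal.rpow_one]
  have hfle : A ≤ (∫⁻ x, (f x + g x) ^ p ∂μ) ^ (1 / p) := by
    refine ENNReal.rpow_le_rpow (lintegral_mono fun x => ?_) hp'.le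
    exact ENNReal.rpow_le_rpow le_self_add hp₀.le
  have hgle : B ≤ (∫⁻ x, (f x + g x) ^ p ∂μ) ^ (1 / p) := by
    refine ENNReal.rpow_le_rpow (lintegral_mono fun x => ?_) hp'.le
    exact ENNReal.rpow_le_rpow le_add_self hp₀.le
  rcases eq_or_ne A 0 with hA0 | hA0
  · rw [hA0, zero_add]; exact hgle
  rcases eq_or_ne B 0 with hB0 | hB0
  · rw [hB0, add_zero]; exact hfle
  rcases eq_or_ne A ∞ with hAt | hAt
  · rw [hAt] at hfle ⊢; simpa using hfle
  rcases eq_or_ne B ∞ with hBt | hBt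
  · rw [hBt] at hgle ⊢; simpa using hgle
  -- The weights are proportional to `A` and `B`: with this choice the integrated left side is
  -- exactly `(A + B) ^ p`.
  have hsum := lintegral_mono (μ := μ) fun x => rpow_mul_add_rpow_mul_le hp₀ hp₁
    (a := A.toReal / (A.toReal + B.toReal)) (b := B.toReal / (A.toReal + B.toReal))
    (by have := ENNReal.toReal_pos hA0 hAt; positivity)
    (by have := ENNReal.toReal_pos hB0 hBt; have := ENNReal.toReal_pos hA0 hAt; positivity)
    (by have := ENNReal.toReal_pos hB0 hBt; have := ENNReal.toReal_pos hA0 hAt; field_simp)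
    (f x) (g x)
  rw [lintegral_add_left (by fun_prop), lintegral_const_mul _ (by fun_prop),
    lintegral_const_mul _ (by fun_prop)] at hsum
  have hIf : ∫⁻ x, f x ^ p ∂μ = A ^ p := (hAB _).symm
  have hIg : ∫⁻ x, g x ^ p ∂μ = B ^ p := (hAB _).symm
  rw [hIf, hIg] at hsum
  have ha := ENNReal.toReal_pos hA0 hAt
  have hb := ENNReal.toReal_pos hB0 hBt
  have hval : ENNReal.ofReal (A.toReal / (A.toReal + B.toReal)) ^ (1 - p) * A ^ p +
      ENNReal.ofReal (B.toReal / (A.toReal + B.toReal)) ^ (1 - p) * B ^ p = (A + B) ^ p := by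
    rw [← ENNReal.ofReal_toReal hAt, ← ENNReal.ofReal_toReal hBt, ← ENNReal.ofReal_add ha.le hb.le,
      ENNReal.toReal_ofReal ha.le, ENNReal.toReal_ofReal hb.le,
      ENNReal.ofReal_rpow_of_pos (by positivity), ENNReal.ofReal_rpow_of_pos (by positivity),
      ENNReal.ofReal_rpow_of_pos (by positivity), ENNReal.ofReal_rpow_of_pos (by positivity),
      ENNReal.ofReal_rpow_of_pos (by positivity), ← ENNReal.ofReal_mul (by positivity),
      ← ENNReal.ofReal_mul (by positivity), ← ENNReal.ofReal_add (by positivity) (by positivity)]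
    congr 1
    rw [Real.div_rpow ha.le (by positivity), Real.div_rpow hb.le (by positivity), div_mul_eq_mul_div,
      div_mul_eq_mul_div, ← Real.rpow_add ha, ← Real.rpow_add hb, ← add_div, sub_add_cancel,
      Real.rpow_one, Real.rpow_one, Real.rpow_sub (by positivity), Real.rpow_one]
    field_simp
  rw [hval] at hsum
  calc A + B = ((A + B) ^ p) ^ (1 / p) := by
        rw [← ENNReal.rpow_mul, mul_one_div_cancel hp₀.ne', ENNReal.rpow_one]
    _ ≤ _ := ENNReal.rpow_le_rpow hsum hp'.le

end ReverseMinkowski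

/-! ## Geodesics ending in a Dirac mass -/

section Geodesics

open CausalSpace LorentzianPreLengthSpace

variable {Y : Type*} [MetricSpace Y] [MeasurableSpace Y] [BorelSpace Y]
  [LorentzianPreLengthSpace Y]

/-- The reverse triangle inequality for `ℓ_p` along four measures, the last a Dirac mass. Only `π`
and `π'` need gluing, because the cost of `π''` is already an integral against `μ₃`. On the glued
space the pointwise reverse triangle inequality is combined with two uses of reverse Minkowski. -/
theorem timeCost_add_add_le (hJ : IsClosed {z : Y × Y | causal z.1 z.2})
    (hτ : Continuous fun z : Y × Y => tau z.1 z.2) {p : ℝ} (hp₀ : 0 < p) (hp₁ : p < 1)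
    {μ₁ μ₂ μ₃ : Measure Y} [IsProbabilityMeasure μ₁] [IsProbabilityMeasure μ₂] {y : Y}
    {π π' π'' : Measure (Y × Y)} (h : IsCausalCoupling π μ₁ μ₂) (h' : IsCausalCoupling π' μ₂ μ₃)
    (h'' : IsCausalCoupling π'' μ₃ (Measure.dirac y)) :
    timeCost p π ^ (1 / p) + timeCost p π' ^ (1 / p) + timeCost p π'' ^ (1 / p) ≤
      (∫⁻ x, tau x y ^ p ∂μ₁) ^ (1 / p) := by
  obtain ⟨γ, hγ, hγ'⟩ := exists_gluing h h'
  have hτm : Measurable fun z : Y × Y => tau z.1 z.2 := hτ.measurable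
  have hτy : Measurable fun x => tau x y :=
    (hτ.comp (by fun_prop : Continuous fun x : Y => (x, y))).measurable
  have h1 : timeCost p π = ∫⁻ w, tau w.1.1 w.1.2 ^ p ∂γ := by
    rw [← hγ, timeCost, lintegral_map (hτm.pow_const p) measurable_fst]
  have h2 : timeCost p π' = ∫⁻ w, tau w.1.2 w.2 ^ p ∂γ := by
    rw [← hγ', timeCost, lintegral_map (hτm.pow_const p) (by fun_prop)]
  have e3 : γ.map Prod.snd = μ₃ := by
    rw [← h'.map_snd, ← hγ', Measure.map_map measurable_snd (by fun_prop)]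
    rfl
  have e1 : γ.map (fun w => w.1.1) = μ₁ := by
    rw [← h.map_fst, ← hγ, Measure.map_map measurable_fst measurable_fst]
    rfl
  have h3 : timeCost p π'' = ∫⁻ w, tau w.2 y ^ p ∂γ := by
    rw [timeCost_of_snd_dirac hτ h'', ← e3, lintegral_map (hτy.pow_const p) measurable_snd]
  have h4 : ∫⁻ x, tau x y ^ p ∂μ₁ = ∫⁻ w, tau w.1.1 y ^ p ∂γ := by
    rw [← e1, lintegral_map (hτy.pow_const p) (by fun_prop)]
  have c1 : ∀ᵐ w ∂γ, causal w.1.1 w.1.2 := by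
    refine (ae_map_iff measurable_fst.aemeasurable hJ.measurableSet).1 ?_
    rw [hγ]; exact h.ae_causal
  have c2 : ∀ᵐ w ∂γ, causal w.1.2 w.2 := by
    refine (ae_map_iff (f := fun w : (Y × Y) × Y => (w.1.2, w.2)) (by fun_prop)
      hJ.measurableSet).1 ?_
    rw [hγ']; exact h'.ae_causal
  have c3 : ∀ᵐ w ∂γ, causal w.2 y := by
    have hy : MeasurableSet {x : Y | causal x y} :=
      (hJ.preimage (by fun_prop : Continuous fun x : Y => (x, y))).measurableSet
    refine (ae_map_iff measurable_snd.aemeasurable hy).1 ?_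
    rw [e3, ← h''.map_fst]
    refine (ae_map_iff measurable_fst.aemeasurable hy).2 ?_
    have : ∀ᵐ z ∂π'', z.2 = y := by
      refine (ae_map_iff measurable_snd.aemeasurable measurableSet_eq).1 ?_
      rw [h''.map_snd, ae_dirac_iff measurableSet_eq]
    filter_upwards [this, h''.ae_causal] with z hz hz'
    rwa [hz] at hz'
  rw [h1, h2, h3, h4]
  refine (add_le_add_left (lintegral_rpow_add_ge hp₀ hp₁ (by fun_prop) (by fun_prop)) _).trans ?_
  refine (lintegral_rpow_add_ge hp₀ hp₁ (by fun_prop) (by fun_prop)).trans ?_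
  refine ENNReal.rpow_le_rpow (lintegral_mono_ae ?_) (by positivity)
  filter_upwards [c1, c2, c3] with w w1 w2 w3
  refine ENNReal.rpow_le_rpow ?_ hp₀.le
  exact (add_le_add_left (reverse_triangle _ _ _ w1 w2) _).trans
    (reverse_triangle _ _ _ (causal_trans _ _ _ w1 w2) w3)

theorem ofReal_one_split {s t : ℝ} (hs : 0 ≤ s) (hst : s ≤ t) (ht : t ≤ 1) :
    ENNReal.ofReal s + ENNReal.ofReal (t - s) + ENNReal.ofReal (1 - t) = 1 := by
  rw [← ENNReal.ofReal_add hs (by linarith), ← ENNReal.ofReal_add (by linarith) (by linarith)]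
  simp

/-- Lower bounds suffice: a coupling between times `s` and `t` costing more than its share, joined
to couplings from `0` to `s` and from `t` to `1`, would exceed the total `L`. -/
theorem isEllPGeodesic_of_couplings (hJ : IsClosed {z : Y × Y | causal z.1 z.2})
    (hτ : Continuous fun z : Y × Y => tau z.1 z.2) {p : ℝ} (hp₀ : 0 < p) (hp₁ : p < 1)
    {ν : Icc (0 : ℝ) 1 → ProbabilityMeasure Y} {y : Y}
    (hν : (ν 1 : Measure Y) = Measure.dirac y) {L : ℝ≥0∞}
    (hL : (∫⁻ x, tau x y ^ p ∂(ν 0 : Measure Y)) ^ (1 / p) = L) (hL₀ : L ≠ 0) (hL₁ : L ≠ ∞)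
    (hc : ∀ s t : Icc (0 : ℝ) 1, s < t → ∃ π : Measure (Y × Y),
      IsCausalCoupling π (ν s : Measure Y) (ν t) ∧
        (ENNReal.ofReal ((t : ℝ) - s) * L) ^ p ≤ timeCost p π) :
    IsEllPGeodesic p ν := by
  have hp' : 0 < 1 / p := by positivity
  -- The diagonal coupling covers `s = t`, which is needed when the outer intervals `[0, s]` or `[t,
  -- 1]` degenerate.
  have hc' : ∀ s t : Icc (0 : ℝ) 1, s ≤ t → ∃ π : Measure (Y × Y),
      IsCausalCoupling π (ν s : Measure Y) (ν t) ∧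
        ENNReal.ofReal ((t : ℝ) - s) * L ≤ timeCost p π ^ (1 / p) := by
    intro s t hst
    rcases hst.eq_or_lt with rfl | hst
    · exact ⟨_, isCausalCoupling_diag hJ _, by simp⟩
    · obtain ⟨π, h1, h2⟩ := hc s t hst
      refine ⟨π, h1, ?_⟩
      have := ENNReal.rpow_le_rpow h2 hp'.le
      rwa [← ENNReal.rpow_mul, mul_one_div_cancel hp₀.ne', ENNReal.rpow_one] at this
  have key : ∀ s t : Icc (0 : ℝ) 1, s ≤ t → ellP p (ν s : Measure Y) (ν t) =
      ((ENNReal.ofReal ((t : ℝ) - s) * L : ℝ≥0∞) : EReal) := by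
    intro s t hst
    refine le_antisymm (iSup₂_le fun π hπ => ?_) ?_
    · obtain ⟨π₁, h1, h1'⟩ := hc' 0 s s.2.1
      obtain ⟨π₃, h3, h3'⟩ := hc' t 1 t.2.2
      rw [hν] at h3
      have h := timeCost_add_add_le hJ hτ hp₀ hp₁ h1 hπ h3
      rw [hL] at h
      simp only [Icc.coe_zero, sub_zero, Icc.coe_one] at h1' h3'
      have h' : (ENNReal.ofReal s * L + ENNReal.ofReal (1 - t) * L) + timeCost p π ^ (1 / p) ≤
          (ENNReal.ofReal s * L + ENNReal.ofReal (1 - t) * L) + ENNReal.ofReal (t - s) * L := by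
        calc (ENNReal.ofReal s * L + ENNReal.ofReal (1 - t) * L) + timeCost p π ^ (1 / p)
            ≤ (timeCost p π₁ ^ (1 / p) + timeCost p π₃ ^ (1 / p)) + timeCost p π ^ (1 / p) := by
              gcongr
          _ = timeCost p π₁ ^ (1 / p) + timeCost p π ^ (1 / p) + timeCost p π₃ ^ (1 / p) := by ring
          _ ≤ L := h
          _ = (ENNReal.ofReal s + ENNReal.ofReal (t - s) + ENNReal.ofReal (1 - t)) * L := by
              rw [ofReal_one_split s.2.1 hst t.2.2, one_mul]
          _ = _ := by ring
      have hfin : ENNReal.ofReal s * L + ENNReal.ofReal (1 - t) * L ≠ ∞ :=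
        ENNReal.add_ne_top.2 ⟨ENNReal.mul_ne_top ENNReal.ofReal_ne_top hL₁,
          ENNReal.mul_ne_top ENNReal.ofReal_ne_top hL₁⟩
      exact_mod_cast (ENNReal.add_le_add_iff_left hfin).1 h'
    · obtain ⟨π, h1, h2⟩ := hc' s t hst
      exact le_trans (by exact_mod_cast h2) (le_ellP h1)
  intro s t hst
  have hst' : (0 : ℝ) < (t : ℝ) - s := sub_pos.2 hst
  rw [key s t hst.le, key 0 1 zero_le_one]
  refine ⟨?_, ?_, ?_⟩
  · simp only [Icc.coe_one, Icc.coe_zero, sub_zero, ENNReal.ofReal_one, one_mul]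
    rw [EReal.coe_ennreal_mul, EReal.coe_ennreal_ofReal, max_eq_left hst'.le]
  · have : (0 : ℝ≥0∞) < ENNReal.ofReal ((t : ℝ) - s) * L :=
      ENNReal.mul_pos (by simpa using hst') hL₀
    exact_mod_cast this
  · exact lt_top_iff_ne_top.2 (EReal.coe_ennreal_eq_top_iff.not.2
      (ENNReal.mul_ne_top ENNReal.ofReal_ne_top hL₁))

end Geodesics

/-! ## Entropy -/

section Entropy

variable {Y : Type*} [MeasurableSpace Y]

/-- `ν` is absolutely continuous with respect to `M` and its entropy is a convergent integral. -/
def FiniteEntropy (ν M : Measure Y) : Prop :=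
  ν ≪ M ∧ Integrable (fun x => density ν M x * Real.log (density ν M x)) M

/-- The entropy as a Bochner integral. -/
noncomputable def entReal (ν M : Measure Y) : ℝ :=
  ∫ x, density ν M x * Real.log (density ν M x) ∂M

theorem FiniteEntropy.entropy_eq {ν M : Measure Y} (h : FiniteEntropy ν M) :
    entropy ν M = (entReal ν M : EReal) := by
  have h1 : ∫⁻ x, ENNReal.ofReal (density ν M x * Real.log (density ν M x)) ∂M ≠ ∞ :=
    h.2.lintegral_lt_top.ne
  have h2 : ∫⁻ x, ENNReal.ofReal (-(density ν M x * Real.log (density ν M x))) ∂M ≠ ∞ :=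
    h.2.neg.lintegral_lt_top.ne
  rw [entropy, if_pos ⟨h.1, h1.lt_top⟩, entReal,
    integral_eq_lintegral_pos_part_sub_lintegral_neg_part h.2, EReal.coe_sub,
    EReal.coe_ennreal_toReal h1, EReal.coe_ennreal_toReal h2]

theorem measurable_density (ν M : Measure Y) : Measurable (density ν M) :=
  (Measure.measurable_rnDeriv ν M).ennreal_toReal

theorem density_nonneg (ν M : Measure Y) (x : Y) : 0 ≤ density ν M x := ENNReal.toReal_nonneg

theorem measurable_density_mul_log (ν M : Measure Y) :
    Measurable fun x => density ν M x * Real.log (density ν M x) :=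
  (measurable_density ν M).mul (Real.measurable_log.comp (measurable_density ν M))

theorem absolutelyContinuous_of_entropy_ne_top {ν M : Measure Y} (h : entropy ν M ≠ ⊤) :
    ν ≪ M ∧ ∫⁻ x, ENNReal.ofReal (density ν M x * Real.log (density ν M x)) ∂M < ∞ := by
  by_contra hcon
  exact h (if_neg hcon)

theorem finiteEntropy_of_lintegral_lt_top {ν M : Measure Y} (hac : ν ≪ M)
    (h1 : ∫⁻ x, ENNReal.ofReal (density ν M x * Real.log (density ν M x)) ∂M < ∞)
    (h2 : ∫⁻ x, ENNReal.ofReal (-(density ν M x * Real.log (density ν M x))) ∂M < ∞) :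
    FiniteEntropy ν M := by
  refine ⟨hac, (measurable_density_mul_log ν M).aestronglyMeasurable, ?_⟩
  rw [hasFiniteIntegral_iff_norm]
  have : ∀ x, ENNReal.ofReal ‖density ν M x * Real.log (density ν M x)‖ ≤
      ENNReal.ofReal (density ν M x * Real.log (density ν M x)) +
        ENNReal.ofReal (-(density ν M x * Real.log (density ν M x))) := by
    intro x
    rw [Real.norm_eq_abs]
    rcases abs_cases (density ν M x * Real.log (density ν M x)) with ⟨h, -⟩ | ⟨h, -⟩ <;> rw [h]
    · exact le_self_add
    · exact le_add_self
  refine (lintegral_mono this).trans_lt ?_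
  rw [lintegral_add_left (measurable_density_mul_log ν M).ennreal_ofReal]
  exact ENNReal.add_lt_top.2 ⟨h1, h2⟩

theorem finiteEntropy_of_ne_top_of_ne_bot {ν M : Measure Y} (h : entropy ν M ≠ ⊤)
    (h' : entropy ν M ≠ ⊥) : FiniteEntropy ν M := by
  obtain ⟨hac, hlt⟩ := absolutelyContinuous_of_entropy_ne_top h
  refine finiteEntropy_of_lintegral_lt_top hac hlt (lt_top_iff_ne_top.2 fun htop => h' ?_)
  rw [entropy, if_pos ⟨hac, hlt⟩, htop, EReal.coe_ennreal_top]
  exact EReal.sub_top _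

theorem neg_mul_log_le_one {r : ℝ} (hr : 0 ≤ r) : -(r * Real.log r) ≤ 1 := by
  rcases hr.eq_or_lt with rfl | hr
  · simp
  · have := mul_le_mul_of_nonneg_left (Real.one_sub_inv_le_log_of_pos hr) hr.le
    rw [mul_sub, mul_inv_cancel₀ hr.ne'] at this
    linarith

theorem density_ae_eq_zero {ν M : Measure Y} [SigmaFinite M] [IsFiniteMeasure ν] {D : Set Y}
    (hD : MeasurableSet D) (hν : ν Dᶜ = 0) : ∀ᵐ x ∂M, x ∉ D → density ν M x = 0 := by
  have h : ∫⁻ x in Dᶜ, ν.rnDeriv M x ∂M = 0 :=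
    le_antisymm ((Measure.setLIntegral_rnDeriv_le _).trans_eq hν) bot_le
  rw [lintegral_eq_zero_iff (Measure.measurable_rnDeriv _ _)] at h
  have h' := (ae_restrict_iff' hD.compl).1 h
  filter_upwards [h'] with x hx hxD
  simp [density, hx hxD]

/-- On a set of finite reference mass the value `-∞` cannot occur, because `-(r log r) ≤ 1`. -/
theorem finiteEntropy_of_ne_top {ν M : Measure Y} [SigmaFinite M] [IsFiniteMeasure ν]
    (h : entropy ν M ≠ ⊤) {D : Set Y} (hD : MeasurableSet D) (hν : ν Dᶜ = 0) (hM : M D < ∞) :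
    FiniteEntropy ν M := by
  obtain ⟨hac, hlt⟩ := absolutelyContinuous_of_entropy_ne_top h
  refine finiteEntropy_of_lintegral_lt_top hac hlt ?_
  calc ∫⁻ x, ENNReal.ofReal (-(density ν M x * Real.log (density ν M x))) ∂M
      ≤ ∫⁻ x, D.indicator 1 x ∂M := by
        refine lintegral_mono_ae ?_
        filter_upwards [density_ae_eq_zero (M := M) hD hν] with x hx
        by_cases hxD : x ∈ D
        · rw [indicator_of_mem hxD, Pi.one_apply, ← ENNReal.ofReal_one]
          exact ENNReal.ofReal_le_ofReal (neg_mul_log_le_one (density_nonneg _ _ _))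
        · simp [hx hxD]
    _ = M D := lintegral_indicator_one hD
    _ < ∞ := hM

theorem FiniteEntropy.entropicU_eq {ν M : Measure Y} (h : FiniteEntropy ν M) (N : ℝ) :
    entropicU N ν M = ENNReal.ofReal (Real.exp (-entReal ν M / N)) := by
  rw [entropicU, h.entropy_eq, ← EReal.coe_neg, ← EReal.coe_div, EReal.exp_coe]

/-- The Fenchel–Young inequality for `r log r`, whose convex conjugate is `exp (t - 1)`; equality
holds at `t = 1 + log r`. -/
theorem young_exp {r : ℝ} (hr : 0 ≤ r) (t : ℝ) :
    r * t ≤ r * Real.log r + Real.exp (t - 1) := by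
  rcases hr.eq_or_lt with rfl | hr
  · simp [Real.exp_nonneg]
  · have h1 := Real.add_one_le_exp (t - 1 - Real.log r)
    rw [Real.exp_sub (t - 1), Real.exp_log hr, le_div_iff₀ hr] at h1
    nlinarith

end Entropy

/-! ### Dual formula for the entropy and joint lower semicontinuity. -/

section EntropyDuality

variable {Y : Type*} [MetricSpace Y] [ProperSpace Y] [MeasurableSpace Y] [BorelSpace Y]

/-- Young's inequality integrated against `M`. The cutoff `χ` is harmless, since the density
vanishes off `D`, and it makes the last integrand a compactly supported continuous function, to
which vague convergence applies. -/
theorem integral_le_entReal_add {ν M : Measure Y} [IsProbabilityMeasure ν]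
    [IsFiniteMeasureOnCompacts M] (h : FiniteEntropy ν M) {χ : Y → ℝ} (hχ : Continuous χ)
    (hχc : HasCompactSupport χ) (hχ₀ : ∀ x, 0 ≤ χ x) {D : Set Y} (hD : MeasurableSet D)
    (hχD : ∀ x ∈ D, χ x = 1) (hν : ν Dᶜ = 0) (φ : BoundedContinuousFunction Y ℝ) :
    ∫ x, φ x ∂ν ≤ entReal ν M + ∫ x, χ x * Real.exp (φ x - 1) ∂M := by
  have h1 : Integrable (fun x => χ x * Real.exp (φ x - 1)) M :=
    (Continuous.integrable_of_hasCompactSupport (by fun_prop) hχc.mul_right)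
  have h2 : Integrable (fun x => density ν M x * φ x) M :=
    (integrable_rnDeriv_smul_iff h.1).2 (φ.integrable ν)
  have h3 : ∫ x, φ x ∂ν = ∫ x, density ν M x * φ x ∂M := (integral_rnDeriv_smul h.1).symm
  rw [h3, entReal, ← integral_add h.2 h1]
  refine integral_mono_ae h2 (h.2.add h1) ?_
  filter_upwards [density_ae_eq_zero (M := M) hD hν] with x hx
  by_cases hxD : x ∈ D
  · simpa [hχD x hxD] using young_exp (density_nonneg ν M x) (φ x)
  · simpa [hx hxD] using mul_nonneg (hχ₀ x) (Real.exp_nonneg _)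

/-- The bounded competitor `1 + log r`, truncated at level `k`. -/
noncomputable def truncLog (k r : ℝ) : ℝ :=
  if r = 0 then -k else max (-k) (min k (1 + Real.log r))

theorem measurable_truncLog (k : ℝ) : Measurable (truncLog k) := by
  unfold truncLog
  exact Measurable.ite (measurableSet_singleton 0) measurable_const (by fun_prop)

theorem abs_truncLog_le {k : ℝ} (hk : 0 ≤ k) (r : ℝ) : |truncLog k r| ≤ k := by
  unfold truncLog
  split_ifs
  · rw [abs_neg, abs_of_nonneg hk]
  · rw [abs_le]
    exact ⟨le_max_left _ _, max_le (by linarith) (min_le_left _ _)⟩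

/-- The concave function `t ↦ r t - exp (t - 1)` peaks at `1 + log r`. Projecting the peak to `[-k,
k]` gives a point between `0` and the peak, so the value there is at least the value `-exp (-1)` at
`0`. This is the integrable lower bound that Fatou's lemma requires. -/
theorem truncLog_bound {k r : ℝ} (hk : 0 ≤ k) (hr : 0 ≤ r) :
    0 ≤ r * truncLog k r - Real.exp (truncLog k r - 1) + Real.exp (-1) := by
  have hconv : ∀ t : ℝ, Real.exp (t - 1) - Real.exp (-1) ≤ t * Real.exp (t - 1) := by
    intro t
    have h1 := Real.add_one_le_exp (-t)
    have h2 : Real.exp (-1) = Real.exp (t - 1) * Real.exp (-t) := by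
      rw [← Real.exp_add]; ring_nf
    have h3 := Real.exp_pos (t - 1)
    nlinarith
  have hmain : truncLog k r * Real.exp (truncLog k r - 1) ≤ r * truncLog k r := by
    rcases hr.eq_or_lt with rfl | hr
    · have : truncLog k 0 = -k := by simp [truncLog]
      rw [this]
      have := Real.exp_pos (-k - 1)
      nlinarith
    · have hd : truncLog k r = max (-k) (min k (1 + Real.log r)) := by simp [truncLog, hr.ne']
      have hexp : Real.exp (1 + Real.log r - 1) = r := by
        rw [add_sub_cancel_left, Real.exp_log hr]
      rcases le_total (1 + Real.log r) (-k) with h1 | h1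
      · have : truncLog k r = -k := by
          rw [hd, min_eq_right (by linarith), max_eq_left h1]
        rw [this]
        have h2 : r ≤ Real.exp (-k - 1) := by
          rw [← hexp]; exact Real.exp_le_exp.2 (by linarith)
        nlinarith
      · rcases le_total (1 + Real.log r) k with h2 | h2
        · have : truncLog k r = 1 + Real.log r := by
            rw [hd, min_eq_right h2, max_eq_right h1]
          rw [this, hexp, mul_comm]
        · have : truncLog k r = k := by
            rw [hd, min_eq_left h2, max_eq_right (by linarith)]
          rw [this]
          have h3 : Real.exp (k - 1) ≤ r := by
            rw [← hexp]; exact Real.exp_le_exp.2 (by linarith)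
          nlinarith
  have := hconv (truncLog k r)
  linarith

theorem tendsto_truncLog {r : ℝ} (hr : 0 < r) :
    Tendsto (fun k : ℕ => r * truncLog k r - Real.exp (truncLog k r - 1)) atTop
      (𝓝 (r * Real.log r)) := by
  refine tendsto_const_nhds.congr' ?_
  filter_upwards [eventually_ge_atTop ⌈|1 + Real.log r|⌉₊] with k hk
  have hk' : |1 + Real.log r| ≤ k := (Nat.le_ceil _).trans (by exact_mod_cast hk)
  rw [abs_le] at hk'
  have : truncLog k r = 1 + Real.log r := by
    simp only [truncLog, hr.ne', if_false]
    rw [min_eq_right hk'.2, max_eq_right hk'.1]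
  rw [this, add_sub_cancel_left, Real.exp_log hr]
  ring

theorem abs_exp_sub_exp_le {a b k : ℝ} (ha : a ≤ k) :
    Real.exp a - Real.exp b ≤ Real.exp k * |a - b| := by
  rcases le_total a b with h | h
  · have := Real.exp_le_exp.2 h
    have := mul_nonneg (Real.exp_nonneg k) (abs_nonneg (a - b))
    linarith
  · rw [abs_of_nonneg (by linarith)]
    have h1 := Real.add_one_le_exp (b - a)
    have h2 : Real.exp b = Real.exp a * Real.exp (b - a) := by rw [← Real.exp_add]; ring_nf
    have h3 := Real.exp_le_exp.2 ha
    have h4 := Real.exp_pos a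
    nlinarith

theorem integral_withDensity_ofReal {M : Measure Y} {χ : Y → ℝ} (hχ : Measurable χ)
    (hχ₀ : ∀ x, 0 ≤ χ x) (f : Y → ℝ) :
    ∫ x, f x ∂(M.withDensity fun x => ENNReal.ofReal (χ x)) = ∫ x, χ x * f x ∂M := by
  have := integral_withDensity_eq_integral_smul (μ := M) (f := fun x => (χ x).toNNReal)
    hχ.real_toNNReal f
  refine Eq.trans this (integral_congr_ae (Eventually.of_forall fun x => ?_))
  simp [NNReal.smul_def, Real.coe_toNNReal _ (hχ₀ x)]

/-- A dual inequality valid for bounded continuous functions holds for bounded Borel functions. -/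
theorem integral_le_of_forall_continuous {ν M : Measure Y} [IsProbabilityMeasure ν]
    [IsFiniteMeasure M] {E : ℝ}
    (h : ∀ φ : BoundedContinuousFunction Y ℝ, ∫ x, φ x ∂ν ≤ E + ∫ x, Real.exp (φ x - 1) ∂M)
    {f : Y → ℝ} (hf : Measurable f) {k : ℝ} (hk : ∀ x, |f x| ≤ k) :
    ∫ x, f x ∂ν ≤ E + ∫ x, Real.exp (f x - 1) ∂M := by
  have hint : ∀ (κ : Measure Y) [IsFiniteMeasure κ] (g : Y → ℝ), Measurable g →
      (∀ x, |g x| ≤ k) → Integrable g κ := fun κ _ g hg hgk =>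
    Integrable.of_bound hg.aestronglyMeasurable k (Eventually.of_forall hgk)
  have hexp : ∀ (g : Y → ℝ), Measurable g →
      (∀ x, |g x| ≤ k) → Integrable (fun x => Real.exp (g x - 1)) M := fun g hg hgk =>
    Integrable.of_bound (by fun_prop) (Real.exp (k - 1)) (Eventually.of_forall fun x => by
      rw [Real.norm_eq_abs, abs_of_nonneg (Real.exp_nonneg _), Real.exp_le_exp]
      linarith [(abs_le.1 (hgk x)).2])
  refine le_of_forall_pos_le_add fun ε hε => ?_
  -- The total error is one `L¹(ν)` error plus the Lipschitz constant `exp (k - 1)` of the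
  -- exponential term times an `L¹(M)` error; approximating in `L¹(ν + M)` controls both.
  set c := 1 + Real.exp (k - 1) with hc
  have hc₀ : 0 < c := by positivity
  obtain ⟨g, hg, -⟩ := (hint (ν + M) f hf hk).exists_boundedContinuous_integral_sub_le
    (div_pos hε hc₀)
  obtain ⟨x₀⟩ : Nonempty Y := by
    by_contra hne
    rw [not_nonempty_iff] at hne
    have := measure_univ (μ := ν)
    rw [univ_eq_empty_iff.2 hne] at this
    simp at this
  have hk₀ : 0 ≤ k := (abs_nonneg _).trans (hk x₀)
  -- Clamping to `[-k, k]` does not increase the distance to `f` and keeps the exponential Lipschitz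
  -- on the relevant range.
  let g' : BoundedContinuousFunction Y ℝ :=
    BoundedContinuousFunction.ofNormedAddCommGroup (fun x => max (-k) (min k (g x)))
      (by fun_prop) k (fun x => by
        rw [Real.norm_eq_abs, abs_le]
        exact ⟨le_max_left _ _, max_le (by linarith) (min_le_left _ _)⟩)
  have hg'k : ∀ x, |g' x| ≤ k := fun x => by
    change |max (-k) (min k (g x))| ≤ k
    rw [abs_le]
    exact ⟨le_max_left _ _, max_le (by linarith) (min_le_left _ _)⟩
  have hg'm : Measurable g' := g'.continuous.measurable
  have hle : ∀ x, |f x - g' x| ≤ |f x - g x| := fun x => by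
    change |f x - max (-k) (min k (g x))| ≤ |f x - g x|
    have h1 := abs_le.1 (hk x)
    have e1 : f x = max (-k) (min k (f x)) := by
      rw [min_eq_right h1.2, max_eq_right h1.1]
    conv_lhs => rw [e1]
    refine (abs_max_sub_max_le_max (-k) _ (-k) _).trans ?_
    rw [sub_self, abs_zero, max_eq_right (abs_nonneg _)]
    refine (abs_min_sub_min_le_max k _ k _).trans ?_
    rw [sub_self, abs_zero, max_eq_right (abs_nonneg _)]
  have hd : ∀ (κ : Measure Y) [IsFiniteMeasure κ], Integrable (fun x => |f x - g' x|) κ :=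
    fun κ _ => ((hint κ f hf hk).sub (hint κ g' hg'm hg'k)).abs
  have htot : ∫ x, |f x - g' x| ∂ν + ∫ x, |f x - g' x| ∂M ≤ ε / c := by
    rw [← integral_add_measure (hd ν) (hd M)]
    refine (integral_mono (hd _) ((hint _ f hf hk).sub (g.integrable _)).abs hle).trans ?_
    exact hg
  have h0ν : 0 ≤ ∫ x, |f x - g' x| ∂ν := integral_nonneg fun x => abs_nonneg _
  have h0M : 0 ≤ ∫ x, |f x - g' x| ∂M := integral_nonneg fun x => abs_nonneg _
  have h1 : ∫ x, f x ∂ν ≤ ∫ x, g' x ∂ν + ∫ x, |f x - g' x| ∂ν := by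
    rw [← integral_add (hint ν g' hg'm hg'k) (hd ν)]
    refine integral_mono (hint ν f hf hk) ((hint ν g' hg'm hg'k).add (hd ν)) fun x => ?_
    have := le_abs_self (f x - g' x)
    linarith
  have h2 : ∫ x, Real.exp (g' x - 1) ∂M ≤
      ∫ x, Real.exp (f x - 1) ∂M + Real.exp (k - 1) * ∫ x, |f x - g' x| ∂M := by
    rw [← integral_const_mul, ← integral_add (hexp f hf hk) ((hd M).const_mul _)]
    refine integral_mono (hexp g' hg'm hg'k) ((hexp f hf hk).add ((hd M).const_mul _)) fun x => ?_
    have := abs_exp_sub_exp_le (a := g' x - 1) (b := f x - 1) (k := k - 1)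
      (by linarith [(abs_le.1 (hg'k x)).2])
    rw [sub_sub_sub_cancel_right, abs_sub_comm] at this
    linarith
  have h3 := h g'
  have h4 : c * (ε / c) = ε := mul_div_cancel₀ _ hc₀.ne'
  have h5 := mul_le_mul_of_nonneg_left htot hc₀.le
  have h6 := Real.exp_pos (k - 1)
  rw [h4] at h5
  nlinarith

/-- The converse half of duality. Extended to bounded Borel functions, the inequality is tested
first with multiples of indicators of null sets, which forces absolute continuity, and then with
truncations of the optimal `1 + log ρ`. -/
theorem finiteEntropy_of_forall_continuous {ν M : Measure Y} [IsProbabilityMeasure ν]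
    [IsFiniteMeasureOnCompacts M] {χ : Y → ℝ} (hχ : Continuous χ)
    (hχc : HasCompactSupport χ) (hχ₀ : ∀ x, 0 ≤ χ x) {D : Set Y} (hD : MeasurableSet D)
    (hχD : ∀ x ∈ D, χ x = 1) (hν : ν Dᶜ = 0) {E : ℝ}
    (h : ∀ φ : BoundedContinuousFunction Y ℝ,
      ∫ x, φ x ∂ν ≤ E + ∫ x, χ x * Real.exp (φ x - 1) ∂M) :
    FiniteEntropy ν M ∧ entReal ν M ≤ E := by
  have hχi : Integrable χ M := hχ.integrable_of_hasCompactSupport hχc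
  set M' := M.withDensity fun x => ENNReal.ofReal (χ x) with hM'
  have hM'fin : IsFiniteMeasure M' := isFiniteMeasure_withDensity_ofReal hχi.2
  have hM'int : ∀ f : Y → ℝ, ∫ x, f x ∂M' = ∫ x, χ x * f x ∂M :=
    integral_withDensity_ofReal hχ.measurable hχ₀
  have hB : ∀ (f : Y → ℝ), Measurable f → ∀ k : ℝ, (∀ x, |f x| ≤ k) →
      ∫ x, f x ∂ν ≤ E + ∫ x, Real.exp (f x - 1) ∂M' := fun f hf k hk =>
    integral_le_of_forall_continuous (fun φ => by rw [hM'int]; exact h φ) hf hk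
  have hac : ν ≪ M := by
    refine Measure.AbsolutelyContinuous.mk fun s hs hs0 => ?_
    have hs' : M' s = 0 := withDensity_absolutelyContinuous _ _ hs0
    have hkey : ∀ k : ℕ, (k : ℝ) * ν.real s ≤ E + ∫ x, Real.exp (-1) ∂M' := by
      intro k
      have h1 := hB (s.indicator fun _ => (k : ℝ)) (measurable_const.indicator hs) k (fun x => by
        by_cases hx : x ∈ s <;> simp [hx])
      rw [integral_indicator_const _ hs, smul_eq_mul, mul_comm] at h1
      refine h1.trans_eq ?_
      congr 1
      refine integral_congr_ae ?_
      have : ∀ᵐ x ∂M', x ∉ s := measure_eq_zero_iff_ae_notMem.1 hs'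
      filter_upwards [this] with x hx
      simp [hx]
    by_contra hne
    have hpos : 0 < ν.real s := ENNReal.toReal_pos hne (measure_ne_top _ _)
    obtain ⟨k, hk⟩ := exists_nat_gt ((E + ∫ x, Real.exp (-1) ∂M') / ν.real s)
    rw [div_lt_iff₀ hpos] at hk
    exact absurd (hkey k) (not_le.2 hk)
  set ρ := density ν M with hρ
  have hρm : Measurable ρ := measurable_density ν M
  have hρ₀ : ∀ x, 0 ≤ ρ x := density_nonneg ν M
  have hρD := density_ae_eq_zero (M := M) hD hν
  -- Adding `χ * exp (-1)` makes the dual integrand nonnegative almost everywhere, so Fatou's lemma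
  -- applies; the added integral is subtracted again at the end.
  let G : ℕ → Y → ℝ := fun k x =>
    ρ x * truncLog k (ρ x) - χ x * Real.exp (truncLog k (ρ x) - 1) + χ x * Real.exp (-1)
  have hGm : ∀ k, Measurable (G k) := fun k => by
    have := (measurable_truncLog k).comp hρm
    have h' : Measurable χ := hχ.measurable
    exact ((hρm.mul this).sub (h'.mul (Real.measurable_exp.comp (this.sub_const 1)))).add
      (h'.mul_const _)
  have hG₀ : ∀ k, ∀ᵐ x ∂M, 0 ≤ G k x := fun k => by
    filter_upwards [hρD] with x hx
    by_cases hxD : x ∈ D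
    · simpa [G, hχD x hxD] using truncLog_bound (Nat.cast_nonneg k) (hρ₀ x)
    · have h0 : ρ x = 0 := hx hxD
      have : Real.exp (-(k : ℝ) - 1) ≤ Real.exp (-1) :=
        Real.exp_le_exp.2 (by linarith [(Nat.cast_nonneg k : (0 : ℝ) ≤ k)])
      have h2 : truncLog k (ρ x) = -k := by simp [truncLog, h0]
      simp only [G, h2]
      rw [h0, zero_mul]
      nlinarith [hχ₀ x]
  have hGint : ∀ k, Integrable (G k) M ∧
      ∫ x, G k x ∂M ≤ E + ∫ x, χ x * Real.exp (-1) ∂M := fun k => by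
    have hm : Measurable fun x => truncLog k (ρ x) := (measurable_truncLog k).comp hρm
    have i1 : Integrable (fun x => ρ x * truncLog k (ρ x)) M :=
      (integrable_rnDeriv_smul_iff hac).2 (Integrable.of_bound hm.aestronglyMeasurable k
        (Eventually.of_forall fun x => abs_truncLog_le (Nat.cast_nonneg k) _))
    have i2 : Integrable (fun x => χ x * Real.exp (truncLog k (ρ x) - 1)) M := by
      refine hχi.mul_bdd (c := Real.exp (k - 1)) (Real.measurable_exp.comp
        (hm.sub_const 1)).aestronglyMeasurable (Eventually.of_forall fun x => ?_)
      rw [Real.norm_eq_abs, abs_of_nonneg (Real.exp_nonneg _), Real.exp_le_exp]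
      linarith [(abs_le.1 (abs_truncLog_le (Nat.cast_nonneg k) (ρ x))).2]
    have i3 : Integrable (fun x => χ x * Real.exp (-1)) M := hχi.mul_const _
    refine ⟨(i1.sub i2).add i3, ?_⟩
    have h1 := hB _ hm k fun x => abs_truncLog_le (Nat.cast_nonneg k) _
    rw [hM'int, ← integral_rnDeriv_smul hac] at h1
    have h2 : ∫ x, G k x ∂M = ∫ x, ρ x * truncLog k (ρ x) ∂M -
        ∫ x, χ x * Real.exp (truncLog k (ρ x) - 1) ∂M + ∫ x, χ x * Real.exp (-1) ∂M := by
      rw [← integral_sub i1 i2]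
      exact integral_add (i1.sub i2) i3
    rw [h2]
    have h3 : ∫ x, ρ x * truncLog k (ρ x) ∂M ≤
      E + ∫ x, χ x * Real.exp (truncLog k (ρ x) - 1) ∂M := h1
    linarith
  let F : Y → ℝ := fun x => ρ x * Real.log (ρ x) + χ x * Real.exp (-1)
  have hlim : ∀ᵐ x ∂M, Tendsto (fun k => G k x) atTop (𝓝 (F x)) := by
    filter_upwards [hρD] with x hx
    rcases (hρ₀ x).eq_or_lt with h0 | h0
    · have h2 : ∀ k : ℕ, G k x = -(χ x * Real.exp (-k - 1)) + χ x * Real.exp (-1) := fun k => by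
        simp [G, ← h0, truncLog]
      have h3 : F x = -(χ x * 0) + χ x * Real.exp (-1) := by simp [F, ← h0]
      rw [h3]
      simp_rw [h2]
      refine Tendsto.add_const _ (Tendsto.neg (Tendsto.const_mul _ ?_))
      refine Real.tendsto_exp_atBot.comp ?_
      have := tendsto_natCast_atTop_atTop (R := ℝ)
      exact tendsto_atBot_add_const_right _ _ (tendsto_neg_atTop_atBot.comp this)
    · have hxD : x ∈ D := by
        by_contra hxD
        exact h0.ne' (hx hxD)
      have := (tendsto_truncLog h0).add_const (Real.exp (-1))
      simpa [G, F, hχD x hxD] using this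
  have hF₀ : ∀ᵐ x ∂M, 0 ≤ F x := by
    filter_upwards [hlim, ae_all_iff.2 hG₀] with x h1 h2
    exact ge_of_tendsto' h1 h2
  have hC₀ : 0 ≤ E + ∫ x, χ x * Real.exp (-1) ∂M :=
    (integral_nonneg_of_ae (hG₀ 0)).trans (hGint 0).2
  have hFm : Measurable F := (measurable_density_mul_log ν M).add (hχ.measurable.mul_const _)
  have hFatou : ∫⁻ x, ENNReal.ofReal (F x) ∂M ≤
      ENNReal.ofReal (E + ∫ x, χ x * Real.exp (-1) ∂M) := by
    calc ∫⁻ x, ENNReal.ofReal (F x) ∂M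
        = ∫⁻ x, liminf (fun k => ENNReal.ofReal (G k x)) atTop ∂M := by
          refine lintegral_congr_ae ?_
          filter_upwards [hlim] with x hx
          exact ((ENNReal.continuous_ofReal.tendsto _).comp hx).liminf_eq.symm
      _ ≤ liminf (fun k => ∫⁻ x, ENNReal.ofReal (G k x) ∂M) atTop :=
          lintegral_liminf_le fun k => (hGm k).ennreal_ofReal
      _ ≤ liminf (fun _ : ℕ => ENNReal.ofReal (E + ∫ x, χ x * Real.exp (-1) ∂M)) atTop := by
          refine liminf_le_liminf (Eventually.of_forall fun k => ?_)
          rw [← ofReal_integral_eq_lintegral_ofReal (hGint k).1 (hG₀ k)]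
          exact ENNReal.ofReal_le_ofReal (hGint k).2
      _ = _ := liminf_const _
  have hFi : Integrable F M := by
    refine ⟨hFm.aestronglyMeasurable, ?_⟩
    rw [hasFiniteIntegral_iff_ofReal hF₀]
    exact hFatou.trans_lt ENNReal.ofReal_lt_top
  have hFle : ∫ x, F x ∂M ≤ E + ∫ x, χ x * Real.exp (-1) ∂M := by
    rw [integral_eq_lintegral_of_nonneg_ae hF₀ hFm.aestronglyMeasurable]
    exact ENNReal.toReal_le_of_le_ofReal hC₀ hFatou
  have i3 : Integrable (fun x => χ x * Real.exp (-1)) M := hχi.mul_const _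
  have hi : Integrable (fun x => ρ x * Real.log (ρ x)) M := by
    have := hFi.sub i3
    refine this.congr (Eventually.of_forall fun x => ?_)
    simp [F]
  refine ⟨⟨hac, hi⟩, ?_⟩
  have : ∫ x, F x ∂M = entReal ν M + ∫ x, χ x * Real.exp (-1) ∂M := integral_add hi i3
  linarith

/-- Lower semicontinuity of the entropy under simultaneous convergence of both measures. -/
theorem entReal_le_of_tendsto {α : Type*} {l : Filter α} [l.NeBot]
    {ν : α → ProbabilityMeasure Y} {ν' : ProbabilityMeasure Y} (hν : Tendsto ν l (𝓝 ν'))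
    {M : α → Measure Y} {M' : Measure Y} (hMfin : ∀ a, IsFiniteMeasureOnCompacts (M a))
    [IsFiniteMeasureOnCompacts M']
    (hM : ∀ φ : Y → ℝ, Continuous φ → HasCompactSupport φ →
      Tendsto (fun a => ∫ y, φ y ∂(M a)) l (𝓝 (∫ y, φ y ∂M')))
    {D : Set Y} (hD : IsCompact D) (hνD : ∀ᶠ a in l, (ν a : Measure Y) Dᶜ = 0)
    {c : α → ℝ} {c' : ℝ} (hc : Tendsto c l (𝓝 c'))
    (h : ∀ᶠ a in l, FiniteEntropy (ν a : Measure Y) (M a) ∧ entReal (ν a : Measure Y) (M a) ≤ c a) :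
    FiniteEntropy (ν' : Measure Y) M' ∧ entReal (ν' : Measure Y) M' ≤ c' := by
  obtain ⟨χ, hχ1, -, hχc, hχ01⟩ := exists_continuous_one_zero_of_isCompact hD isClosed_empty
    (disjoint_empty D)
  refine finiteEntropy_of_forall_continuous χ.continuous hχc (fun x => (hχ01 x).1)
    hD.measurableSet (fun x hx => hχ1 hx)
    (measure_compl_eq_zero_of_tendsto hν hD.isClosed hνD) fun φ => ?_
  have h1 := ProbabilityMeasure.tendsto_iff_forall_integral_tendsto.1 hν φ
  have h2 := hM (fun x => χ x * Real.exp (φ x - 1)) (by fun_prop) hχc.mul_right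
  -- For fixed `φ` both sides of the dual inequality converge, the left by weak and the right by
  -- vague convergence.
  refine le_of_tendsto_of_tendsto h1 (hc.add h2) ?_
  filter_upwards [hνD, h] with a ha ha'
  have := hMfin a
  have h3 := integral_le_entReal_add ha'.1 χ.continuous hχc (fun x => (hχ01 x).1)
    hD.measurableSet (fun x hx => hχ1 hx) ha φ
  linarith [ha'.2]

end EntropyDuality

/-! ## Normalised densities -/

section NormalisedDensities

variable {Y : Type*} [MetricSpace Y] [ProperSpace Y] [MeasurableSpace Y] [BorelSpace Y]

/-- A nonnegative density of positive finite mass and finite entropy. -/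
structure IsEntropyDensity (M : Measure Y) (h : Y → ℝ) : Prop where
  measurable : Measurable h
  nonneg : ∀ x, 0 ≤ h x
  integrable : Integrable h M
  integrable_mul_log : Integrable (fun x => h x * Real.log (h x)) M
  integral_pos : 0 < ∫ x, h x ∂M

namespace IsEntropyDensity

variable {M : Measure Y} {h : Y → ℝ}

theorem isProbabilityMeasure (H : IsEntropyDensity M h) :
    IsProbabilityMeasure (M.withDensity fun x => ENNReal.ofReal (h x / ∫ y, h y ∂M)) := by
  refine ⟨?_⟩
  rw [withDensity_apply _ MeasurableSet.univ, Measure.restrict_univ,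
    ← ofReal_integral_eq_lintegral_ofReal (H.integrable.div_const _)
      (Eventually.of_forall fun x => div_nonneg (H.nonneg x) H.integral_pos.le),
    integral_div, div_self H.integral_pos.ne', ENNReal.ofReal_one]

/-- The probability measure with density proportional to `h`. -/
noncomputable def prob (H : IsEntropyDensity M h) : ProbabilityMeasure Y :=
  ⟨M.withDensity fun x => ENNReal.ofReal (h x / ∫ y, h y ∂M), H.isProbabilityMeasure⟩

theorem coe_prob (H : IsEntropyDensity M h) : (H.prob : Measure Y) =
    M.withDensity fun x => ENNReal.ofReal (h x / ∫ y, h y ∂M) := rfl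

theorem ae_prob (H : IsEntropyDensity M h) {P : Y → Prop} (hP : ∀ᵐ x ∂M, h x ≠ 0 → P x) :
    ∀ᵐ x ∂(H.prob : Measure Y), P x := by
  rw [H.coe_prob, ae_withDensity_iff (H.measurable.div_const _).ennreal_ofReal]
  filter_upwards [hP] with x hx hx'
  refine hx fun h0 => hx' ?_
  simp [h0]

theorem integral_prob (H : IsEntropyDensity M h) (ψ : Y → ℝ) :
    ∫ x, ψ x ∂(H.prob : Measure Y) = (∫ x, h x * ψ x ∂M) / ∫ y, h y ∂M := by
  rw [H.coe_prob, integral_withDensity_ofReal (H.measurable.div_const _)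
    (fun x => div_nonneg (H.nonneg x) H.integral_pos.le), ← integral_div]
  refine integral_congr_ae (Eventually.of_forall fun x => ?_)
  simp only
  ring

/-- With `Z` the total mass, the entropy is an expression in `∫ h log h` and `Z`, so convergence of
these two integrals already gives convergence of entropies. -/
theorem entropy_prob [IsFiniteMeasureOnCompacts M] (H : IsEntropyDensity M h) :
    FiniteEntropy (H.prob : Measure Y) M ∧ entReal (H.prob : Measure Y) M =
      (∫ x, h x * Real.log (h x) ∂M) / (∫ y, h y ∂M) - Real.log (∫ y, h y ∂M) := by
  set Z := ∫ y, h y ∂M with hZ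
  have hZ₀ : 0 < Z := H.integral_pos
  have h1 : density (H.prob : Measure Y) M =ᵐ[M] fun x => h x / Z := by
    filter_upwards [Measure.rnDeriv_withDensity M (H.measurable.div_const Z).ennreal_ofReal]
      with x hx
    rw [density, H.coe_prob, hx, ENNReal.toReal_ofReal (div_nonneg (H.nonneg x) hZ₀.le)]
  have h2 : (fun x => density (H.prob : Measure Y) M x *
      Real.log (density (H.prob : Measure Y) M x)) =ᵐ[M]
      fun x => (h x * Real.log (h x)) / Z - h x * (Real.log Z / Z) := by
    filter_upwards [h1] with x hx
    rw [hx]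
    rcases eq_or_ne (h x) 0 with h0 | h0
    · simp [h0]
    · rw [Real.log_div h0 hZ₀.ne']
      ring
  have hi : Integrable (fun x => (h x * Real.log (h x)) / Z - h x * (Real.log Z / Z)) M :=
    (H.integrable_mul_log.div_const _).sub (H.integrable.mul_const _)
  refine ⟨⟨withDensity_absolutelyContinuous _ _, hi.congr h2.symm⟩, ?_⟩
  rw [entReal, integral_congr_ae h2,
    integral_sub (H.integrable_mul_log.div_const _) (H.integrable.mul_const _), integral_div,
    integral_mul_const, ← hZ]
  field_simp

end IsEntropyDensity

/-- Limits of normalised densities belong to a closed set containing the approximating ones. -/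
theorem IsEntropyDensity.mem_of_tendsto {α : Type*} {l : Filter α} [l.NeBot]
    {M : α → Measure Y} {M' : Measure Y} (hM : ∀ a, IsFiniteMeasureOnCompacts (M a))
    [IsFiniteMeasureOnCompacts M'] {h : α → Y → ℝ} {h' : Y → ℝ} (H : IsEntropyDensity M' h')
    (hm : ∀ a, Measurable (h a)) (h₀ : ∀ a x, 0 ≤ h a x) (hi : ∀ a, Integrable (h a) (M a))
    (hl : ∀ a, Integrable (fun x => h a x * Real.log (h a x)) (M a))
    (t1 : Tendsto (fun a => ∫ x, h a x ∂(M a)) l (𝓝 (∫ x, h' x ∂M')))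
    (t2 : Tendsto (fun a => ∫ x, h a x * Real.log (h a x) ∂(M a)) l
      (𝓝 (∫ x, h' x * Real.log (h' x) ∂M')))
    (t3 : ∀ ψ : BoundedContinuousFunction Y ℝ,
      Tendsto (fun a => ∫ x, h a x * ψ x ∂(M a)) l (𝓝 (∫ x, h' x * ψ x ∂M')))
    {G : Set (ProbabilityMeasure Y × ℝ)} (hG : IsClosed G)
    (hmem : ∀ᶠ a in l, ∀ Ha : IsEntropyDensity (M a) (h a),
      (Ha.prob, entReal (Ha.prob : Measure Y) (M a)) ∈ G) :
    (H.prob, entReal (H.prob : Measure Y) M') ∈ G := by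
  classical
  have hpos : ∀ᶠ a in l, IsEntropyDensity (M a) (h a) := by
    filter_upwards [t1.eventually (lt_mem_nhds H.integral_pos)] with a ha
    exact ⟨hm a, h₀ a, hi a, hl a, ha⟩
  -- The mass of `h a` is positive only eventually; the default value at the other indices does not
  -- affect the limit.
  let π : α → ProbabilityMeasure Y := fun a =>
    if Ha : IsEntropyDensity (M a) (h a) then Ha.prob else H.prob
  have hπ : ∀ a (Ha : IsEntropyDensity (M a) (h a)), π a = Ha.prob := fun a Ha => dif_pos Ha
  have c1 : Tendsto π l (𝓝 H.prob) := by
    refine ProbabilityMeasure.tendsto_iff_forall_integral_tendsto.2 fun ψ => ?_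
    rw [H.integral_prob]
    refine ((t3 ψ).div t1 H.integral_pos.ne').congr' ?_
    filter_upwards [hpos] with a Ha
    rw [hπ a Ha, Ha.integral_prob]
    rfl
  have c2 : Tendsto (fun a => entReal (π a : Measure Y) (M a)) l
      (𝓝 (entReal (H.prob : Measure Y) M')) := by
    rw [H.entropy_prob.2]
    refine ((t2.div t1 H.integral_pos.ne').sub
      ((Real.continuousAt_log H.integral_pos.ne').tendsto.comp t1)).congr' ?_
    filter_upwards [hpos] with a Ha
    have := hM a
    rw [hπ a Ha, Ha.entropy_prob.2]
    rfl
  refine hG.mem_of_tendsto (c1.prodMk_nhds c2) ?_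
  filter_upwards [hpos, hmem] with a Ha ha
  rw [hπ a Ha]
  exact ha Ha

/-- The dominated version, for a fixed reference measure. -/
theorem IsEntropyDensity.mem_of_dominated {M : Measure Y} [IsFiniteMeasureOnCompacts M]
    {h : ℕ → Y → ℝ} {h' : Y → ℝ} (H : IsEntropyDensity M h')
    (hm : ∀ a, Measurable (h a)) (h₀ : ∀ a x, 0 ≤ h a x) {g₁ g₂ : Y → ℝ}
    (hg₁ : Integrable g₁ M) (hg₂ : Integrable g₂ M) (b₁ : ∀ a, ∀ᵐ x ∂M, h a x ≤ g₁ x)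
    (b₂ : ∀ a, ∀ᵐ x ∂M, |h a x * Real.log (h a x)| ≤ g₂ x)
    (hlim : ∀ᵐ x ∂M, Tendsto (fun a => h a x) atTop (𝓝 (h' x)))
    {G : Set (ProbabilityMeasure Y × ℝ)} (hG : IsClosed G)
    (hmem : ∀ a, ∀ Ha : IsEntropyDensity M (h a),
      (Ha.prob, entReal (Ha.prob : Measure Y) M) ∈ G) :
    (H.prob, entReal (H.prob : Measure Y) M) ∈ G := by
  have b₁' : ∀ a, ∀ᵐ x ∂M, ‖h a x‖ ≤ g₁ x := fun a => by
    filter_upwards [b₁ a] with x hx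
    rwa [Real.norm_eq_abs, abs_of_nonneg (h₀ a x)]
  have hlm : ∀ a, Measurable fun x => h a x * Real.log (h a x) := fun a =>
    (hm a).mul (Real.measurable_log.comp (hm a))
  refine H.mem_of_tendsto (l := atTop) (fun _ => inferInstance) hm h₀
    (fun a => hg₁.mono' (hm a).aestronglyMeasurable (b₁' a))
    (fun a => hg₂.mono' (hlm a).aestronglyMeasurable (b₂ a)) ?_ ?_ ?_ hG (Eventually.of_forall hmem)
  · exact tendsto_integral_of_dominated_convergence g₁ (fun a => (hm a).aestronglyMeasurable) hg₁
      b₁' hlim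
  · refine tendsto_integral_of_dominated_convergence g₂ (fun a => (hlm a).aestronglyMeasurable) hg₂
      b₂ ?_
    filter_upwards [hlim] with x hx
    exact (Real.continuous_mul_log.tendsto _).comp hx
  · intro ψ
    refine tendsto_integral_of_dominated_convergence (fun x => g₁ x * ‖ψ‖)
      (fun a => ((hm a).mul ψ.continuous.measurable).aestronglyMeasurable) (hg₁.mul_const _)
      (fun a => ?_) ?_
    · filter_upwards [b₁' a] with x hx
      rw [norm_mul]
      exact mul_le_mul hx (ψ.norm_coe_le_norm x) (norm_nonneg _) ((norm_nonneg _).trans hx)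
    · filter_upwards [hlim] with x hx
      exact hx.mul_const _

end NormalisedDensities

/-! ## Approximation of initial measures -/

section Approximation

open CausalSpace LorentzianPreLengthSpace

variable {Y : Type*} [MetricSpace Y] [MeasurableSpace Y] [BorelSpace Y]
  [LorentzianPreLengthSpace Y]

/-- `ν` is an admissible initial measure of a contraction towards `y` in the space with
reference measure `M` living on `S`; moreover `ν` is concentrated on `C`. -/
structure IsAdmissible (M : Measure Y) (S C : Set Y) (ν : ProbabilityMeasure Y) (y : Y) :
    Prop where
  mem : y ∈ S
  exists_compact : ∃ K, IsCompact K ∧ K ⊆ S ∧ (ν : Measure Y) Kᶜ = 0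
  measure_compl : (ν : Measure Y) Cᶜ = 0
  finiteEntropy : FiniteEntropy (ν : Measure Y) M
  ae_chron : ∀ᵐ x ∂(ν : Measure Y), chron x y

/-- Measures, with their entropies, that are admissible in a space of index at least `m` for some
target in `W`. -/
def admissibleSet (M : ℕ → Measure Y) (S : ℕ → Set Y) (C W : Set Y) (m : ℕ) :
    Set (ProbabilityMeasure Y × ℝ) :=
  {q | ∃ n, m ≤ n ∧ ∃ y ∈ W, IsAdmissible (M n) (S n) C q.1 y ∧
    entReal (q.1 : Measure Y) (M n) = q.2}

theorem hasCompactSupport_mul_log {f : Y → ℝ} (hf : HasCompactSupport f) :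
    HasCompactSupport fun x => f x * Real.log (f x) :=
  hf.mul_right

theorem continuous_mul_log_comp {f : Y → ℝ} (hf : Continuous f) :
    Continuous fun x => f x * Real.log (f x) := Real.continuous_mul_log.comp hf

/-- The part of `tsupport f` inside `S n` need not be compact. Cutting `f` down to a compact
exhaustion of `S n` produces admissible measures, and dominated convergence recovers the measure and
its entropy. -/
theorem mem_closure_admissibleSet_of_index {M : ℕ → Measure Y} {S : ℕ → Set Y} {C W : Set Y}
    {m n : ℕ} (hmn : m ≤ n) [IsFiniteMeasureOnCompacts (M n)] (hS : IsSigmaCompact (S n))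
    (hMS : M n (S n)ᶜ = 0) {f : Y → ℝ} (hfC : tsupport f ⊆ C) {y : Y} (hyS : y ∈ S n) (hyW : y ∈ W)
    (hfy : ∀ x ∈ tsupport f, 0 < tau x y) (H : IsEntropyDensity (M n) f) :
    (H.prob, entReal (H.prob : Measure Y) (M n)) ∈ closure (admissibleSet M S C W m) := by
  classical
  obtain ⟨K, hK, hKS⟩ := hS
  have hA : ∀ k, IsCompact (accumulate K k) := fun k => isCompact_accumulate hK k
  have hAS : ∀ k, accumulate K k ⊆ S n := fun k => by
    rw [← hKS]
    exact accumulate_subset_iUnion k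
  refine H.mem_of_dominated (h := fun k => (accumulate K k).indicator f) (g₁ := f)
    (g₂ := fun x => |f x * Real.log (f x)|)
    (fun k => H.measurable.indicator (hA k).measurableSet)
    (fun k x => indicator_nonneg (fun x _ => H.nonneg x) x) H.integrable H.integrable_mul_log.abs
    (fun k => Eventually.of_forall fun x => indicator_le_self' (fun _ _ => H.nonneg _) x)
    (fun k => Eventually.of_forall fun x => ?_) ?_ isClosed_closure (fun k Hk => ?_)
  · by_cases hx : x ∈ accumulate K k
    · simp [hx]
    · simp only [hx, not_false_eq_true, indicator_of_notMem, zero_mul, abs_zero]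
      exact abs_nonneg _
  · have : ∀ᵐ x ∂(M n), x ∈ S n := hMS
    filter_upwards [this] with x hx
    rw [← hKS] at hx
    obtain ⟨i, hi⟩ := mem_iUnion.1 hx
    refine tendsto_const_nhds.congr' ?_
    filter_upwards [eventually_ge_atTop i] with k hk
    have : x ∈ accumulate K k := mem_accumulate.2 ⟨i, hk, hi⟩
    simp [this]
  · have hne : ∀ x, (accumulate K k).indicator f x ≠ 0 → x ∈ accumulate K k ∧ x ∈ tsupport f := by
      intro x hx
      have h1 : x ∈ accumulate K k := by
        by_contra h
        exact hx (indicator_of_notMem h f)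
      refine ⟨h1, subset_tsupport _ fun h2 => hx ?_⟩
      rw [indicator_of_mem h1, h2]
    refine subset_closure ⟨n, hmn, y, hyW, ⟨hyS, ⟨_, hA k, hAS k, ?_⟩, ?_, Hk.entropy_prob.1, ?_⟩,
      rfl⟩
    · exact Hk.ae_prob (P := fun x => x ∈ accumulate K k)
        (Eventually.of_forall fun x hx => (hne x hx).1)
    · exact Hk.ae_prob (P := fun x => x ∈ C) (Eventually.of_forall fun x hx => hfC (hne x hx).2)
    · exact Hk.ae_prob (Eventually.of_forall fun x hx => (tau_pos_iff _ _).1 (hfy x (hne x hx).2))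

/-- This supplies the approximating targets. A bump function at `y` has positive `M'`-integral,
hence eventually positive `M n`-integral, and `M n` is carried by `S n`. -/
theorem eventually_exists_mem_near {M : ℕ → Measure Y} {M' : Measure Y} {S : ℕ → Set Y}
    [IsFiniteMeasureOnCompacts M'] (hMS : ∀ n, M n (S n)ᶜ = 0)
    (hM : ∀ φ : Y → ℝ, Continuous φ → HasCompactSupport φ →
      Tendsto (fun n => ∫ y, φ y ∂(M n)) atTop (𝓝 (∫ y, φ y ∂M')))
    {y : Y} (hy : ∀ U ∈ 𝓝 y, 0 < M' U) {W : Set Y} (hW : W ∈ 𝓝 y) :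
    ∀ᶠ n in atTop, ∃ w ∈ W, w ∈ S n := by
  obtain ⟨f, hf1, hf0, hfc, hf01⟩ := exists_continuous_one_zero_of_isCompact
    (isCompact_singleton (x := y)) (isOpen_interior (s := W)).isClosed_compl
    (disjoint_singleton_left.2 fun h => h (mem_interior_iff_mem_nhds.2 hW))
  have hpos : 0 < ∫ x, f x ∂M' := by
    rw [integral_pos_iff_support_of_nonneg (fun x => (hf01 x).1)
      (f.continuous.integrable_of_hasCompactSupport hfc)]
    refine hy _ ?_
    have : f y = 1 := hf1 rfl
    exact (isOpen_ne_fun f.continuous continuous_const).mem_nhds (by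
      change f y ≠ 0
      rw [this]; exact one_ne_zero)
  filter_upwards [(hM f f.continuous hfc).eventually (lt_mem_nhds hpos)] with n hn
  by_contra hcon
  push Not at hcon
  refine hn.ne' (integral_eq_zero_of_ae ?_)
  have : ∀ᵐ x ∂(M n), x ∈ S n := hMS n
  filter_upwards [this] with x hx
  exact hf0 fun hx' => hcon x (interior_subset hx') hx

/-- Keeping the density and changing only the reference measure works because `f`, `f log f` and `f
ψ` are all continuous with compact support. -/
theorem mem_closure_admissibleSet_of_continuous {M : ℕ → Measure Y} {M' : Measure Y}
    {S : ℕ → Set Y} {C W : Set Y} (m : ℕ) (hMf : ∀ n, IsFiniteMeasureOnCompacts (M n))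
    [IsFiniteMeasureOnCompacts M'] (hS : ∀ n, IsSigmaCompact (S n)) (hMS : ∀ n, M n (S n)ᶜ = 0)
    (hM : ∀ φ : Y → ℝ, Continuous φ → HasCompactSupport φ →
      Tendsto (fun n => ∫ y, φ y ∂(M n)) atTop (𝓝 (∫ y, φ y ∂M')))
    (hτ : Continuous fun z : Y × Y => tau z.1 z.2)
    {y : Y} (hy : ∀ U ∈ 𝓝 y, 0 < M' U) (hW : W ∈ 𝓝 y)
    {f : Y → ℝ} (hf : Continuous f) (hfc : HasCompactSupport f) (hfC : tsupport f ⊆ C)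
    (hfy : ∀ x ∈ tsupport f, 0 < tau x y) (H : IsEntropyDensity M' f) :
    (H.prob, entReal (H.prob : Measure Y) M') ∈ closure (admissibleSet M S C W m) := by
  have hflc := continuous_mul_log_comp hf
  have hfls := hasCompactSupport_mul_log hfc
  -- The target must move into `S n`; by compactness of the support of `f`, all its points stay
  -- chronologically before every target close to `y`.
  have hnear : ∀ᶠ w in 𝓝 y, ∀ x ∈ tsupport f, 0 < tau x w := by
    have hopen : IsOpen {z : Y × Y | 0 < tau z.1 z.2} := isOpen_lt continuous_const hτ
    have : (tsupport f ×ˢ {y} : Set (Y × Y)) ⊆ {z : Y × Y | 0 < tau z.1 z.2} := by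
      rintro ⟨x, w⟩ ⟨hx, hw⟩
      obtain rfl : w = y := hw
      exact hfy x hx
    obtain ⟨U, V, -, hV, hU', hV', hUV⟩ :=
      generalized_tube_lemma hfc.isCompact (isCompact_singleton (x := y)) hopen this
    filter_upwards [hV.mem_nhds (hV' rfl)] with w hw x hx using hUV (mk_mem_prod (hU' hx) hw)
  refine H.mem_of_tendsto (l := atTop) hMf (fun _ => H.measurable) (fun _ => H.nonneg)
    (fun n => hf.integrable_of_hasCompactSupport hfc)
    (fun n => hflc.integrable_of_hasCompactSupport hfls) (hM f hf hfc) (hM _ hflc hfls)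
    (fun ψ => hM _ (hf.mul ψ.continuous) hfc.mul_right) isClosed_closure ?_
  filter_upwards [eventually_exists_mem_near hMS hM hy (inter_mem hW hnear),
    eventually_ge_atTop m] with n hn hmn Hn
  obtain ⟨w, ⟨hwW, hw⟩, hwS⟩ := hn
  have := hMf n
  exact mem_closure_admissibleSet_of_index hmn (hS n) (hMS n) hfC hwS hwW hw Hn

theorem exists_bound_mul_log (k : ℝ) :
    ∃ c, 0 ≤ c ∧ ∀ r ∈ Icc 0 k, |r * Real.log r| ≤ c := by
  obtain ⟨c, hc⟩ := ((isCompact_Icc (a := (0 : ℝ)) (b := k)).image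
    (continuous_abs.comp Real.continuous_mul_log)).bddAbove
  exact ⟨max c 0, le_max_right _ _, fun r hr => (hc ⟨r, hr, rfl⟩).trans (le_max_left _ _)⟩

/-- Continuous `L¹`-approximations of `h` are clamped to `[0, k]` and cut off by `χ` to a compact
`L` on which `τ(·, y)` is still positive. A subsequence converges almost everywhere, dominated by
constants on `L`. -/
theorem mem_closure_admissibleSet_of_bounded {M : ℕ → Measure Y} {M' : Measure Y}
    {S : ℕ → Set Y} {C W : Set Y} (m : ℕ) (hMf : ∀ n, IsFiniteMeasureOnCompacts (M n))
    [IsFiniteMeasureOnCompacts M'] (hS : ∀ n, IsSigmaCompact (S n)) (hMS : ∀ n, M n (S n)ᶜ = 0)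
    (hM : ∀ φ : Y → ℝ, Continuous φ → HasCompactSupport φ →
      Tendsto (fun n => ∫ y, φ y ∂(M n)) atTop (𝓝 (∫ y, φ y ∂M')))
    (hτ : Continuous fun z : Y × Y => tau z.1 z.2)
    {y : Y} (hy : ∀ U ∈ 𝓝 y, 0 < M' U) (hW : W ∈ 𝓝 y) {K : Set Y} (hK : IsCompact K)
    (hKC : K ⊆ interior C) (hKy : ∀ x ∈ K, 0 < tau x y) {h : Y → ℝ} {k : ℝ}
    (hk : ∀ x, h x ≤ k) (hhK : ∀ x, x ∉ K → h x = 0) (H : IsEntropyDensity M' h) :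
    (H.prob, entReal (H.prob : Measure Y) M') ∈ closure (admissibleSet M S C W m) := by
  have hτy : Continuous fun x => tau x y := hτ.comp (by fun_prop : Continuous fun x : Y => (x, y))
  have hopen : IsOpen (interior C ∩ {x | 0 < tau x y}) :=
    isOpen_interior.inter (isOpen_lt continuous_const hτy)
  obtain ⟨L, hL, hKL, hLU⟩ := exists_compact_between hK hopen fun x hx => ⟨hKC hx, hKy x hx⟩
  obtain ⟨χ, hχ1, hχ0, hχc, hχ01⟩ := exists_continuous_one_zero_of_isCompact hK
    (isOpen_interior (s := L)).isClosed_compl (disjoint_compl_right_iff_subset.2 hKL)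
  have hχL : tsupport χ ⊆ L := by
    refine closure_minimal (fun x hx => ?_) hL.isClosed
    by_contra hxL
    exact hx (hχ0 fun h' => hxL (interior_subset h'))
  have happ : ∀ i : ℕ, ∃ g : Y → ℝ, HasCompactSupport g ∧
      ∫⁻ x, ‖h x - g x‖ₑ ∂M' ≤ (i + 1 : ℝ≥0∞)⁻¹ ∧ Continuous g ∧ Integrable g M' := fun i =>
    H.integrable.exists_hasCompactSupport_lintegral_sub_le (by simp)
  choose g hgc hgle hg hgi using happ
  let f : ℕ → Y → ℝ := fun i x => χ x * max 0 (min k (g i x))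
  have hk₀ : ∀ x : Y, 0 ≤ k := fun x => (H.nonneg x).trans (hk x)
  have hmeas : TendstoInMeasure M' g atTop h := by
    refine tendstoInMeasure_of_tendsto_eLpNorm one_ne_zero
      (fun i => (hg i).aestronglyMeasurable) H.measurable.aestronglyMeasurable ?_
    have hz : Tendsto (fun i : ℕ => ((i : ℝ≥0∞) + 1)⁻¹) atTop (𝓝 0) := by
      have := (tendsto_add_atTop_iff_nat 1).2 ENNReal.tendsto_inv_nat_nhds_zero
      simpa using this
    refine tendsto_of_tendsto_of_tendsto_of_le_of_le tendsto_const_nhds hz (fun i => bot_le)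
      fun i => ?_
    rw [eLpNorm_one_eq_lintegral_enorm]
    refine le_trans (le_of_eq (lintegral_congr fun x => ?_)) (hgle i)
    rw [Pi.sub_apply, ← enorm_neg, neg_sub]
  obtain ⟨ns, -, hns⟩ := hmeas.exists_seq_tendsto_ae
  obtain ⟨c, hc₀, hc⟩ := exists_bound_mul_log k
  have hfk : ∀ i x, f i x ∈ Icc 0 k := fun i x => by
    have h1 : 0 ≤ max 0 (min k (g i x)) := le_max_left _ _
    have h2 : max 0 (min k (g i x)) ≤ k := max_le (hk₀ x) (min_le_left _ _)
    exact ⟨mul_nonneg (hχ01 x).1 h1, by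
      have := mul_le_mul (hχ01 x).2 h2 h1 zero_le_one
      simpa [f] using this⟩
  have hLfin : M' L ≠ ∞ := hL.measure_lt_top.ne
  have hf0 : ∀ i x, x ∉ L → f i x = 0 := fun i x hx => by
    have : χ x = 0 := hχ0 fun h' => hx (interior_subset h')
    simp [f, this]
  have hfc : ∀ i, Continuous (f i) := fun i =>
    χ.continuous.mul (continuous_const.max (continuous_const.min (hg i)))
  refine H.mem_of_dominated (h := fun i => f (ns i)) (g₁ := L.indicator fun _ => k)
    (g₂ := L.indicator fun _ => c) (fun i => (hfc _).measurable) (fun i x => (hfk _ x).1)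
    ((integrable_indicator_iff hL.measurableSet).2 (integrableOn_const hLfin))
    ((integrable_indicator_iff hL.measurableSet).2 (integrableOn_const hLfin))
    (fun i => Eventually.of_forall fun x => ?_) (fun i => Eventually.of_forall fun x => ?_) ?_
    isClosed_closure (fun i Hi => ?_)
  · by_cases hx : x ∈ L
    · rw [indicator_of_mem hx]; exact (hfk _ x).2
    · rw [indicator_of_notMem hx, hf0 _ x hx]
  · by_cases hx : x ∈ L
    · rw [indicator_of_mem hx]; exact hc _ (hfk _ x)
    · rw [indicator_of_notMem hx, hf0 _ x hx]; simp
  · filter_upwards [hns] with x hx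
    -- Clamping and cutting off leave `h` unchanged, so the modified approximations still converge
    -- to it.
    have h1 : h x = χ x * max 0 (min k (h x)) := by
      by_cases hxK : x ∈ K
      · rw [hχ1 hxK, min_eq_right (hk x), max_eq_right (H.nonneg x)]
        simp
      · rw [hhK x hxK, min_eq_right (hk₀ x)]
        simp
    rw [h1]
    exact Tendsto.const_mul _ (tendsto_const_nhds.max (tendsto_const_nhds.min hx))
  · have hts : tsupport (f (ns i)) ⊆ L := by
      refine closure_minimal (fun x hx => ?_) hL.isClosed
      by_contra hxL
      exact hx (hf0 _ x hxL)
    exact mem_closure_admissibleSet_of_continuous m hMf hS hMS hM hτ hy hW (hfc _)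
      (HasCompactSupport.of_support_subset_isCompact hL (subset_closure.trans hts))
      (hts.trans (hLU.trans (inter_subset_left.trans interior_subset)))
      (fun x hx => (hLU (hts hx)).2) Hi

/-- Every admissible initial measure of the limit space is a limit of admissible ones. -/
theorem mem_closure_admissibleSet {M : ℕ → Measure Y} {M' : Measure Y}
    {S : ℕ → Set Y} {C W : Set Y} (m : ℕ) (hMf : ∀ n, IsFiniteMeasureOnCompacts (M n))
    [IsFiniteMeasureOnCompacts M'] (hS : ∀ n, IsSigmaCompact (S n)) (hMS : ∀ n, M n (S n)ᶜ = 0)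
    (hM : ∀ φ : Y → ℝ, Continuous φ → HasCompactSupport φ →
      Tendsto (fun n => ∫ y, φ y ∂(M n)) atTop (𝓝 (∫ y, φ y ∂M')))
    (hτ : Continuous fun z : Y × Y => tau z.1 z.2)
    {y : Y} (hy : ∀ U ∈ 𝓝 y, 0 < M' U) (hW : W ∈ 𝓝 y) {C' : Set Y} (hC' : IsCompact C')
    (hC : C' ⊆ interior C) {ν : ProbabilityMeasure Y} (hν : (ν : Measure Y) C'ᶜ = 0)
    (hent : FiniteEntropy (ν : Measure Y) M') (hchron : ∀ᵐ x ∂(ν : Measure Y), chron x y) :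
    (ν, entReal (ν : Measure Y) M') ∈ closure (admissibleSet M S C W m) := by
  have hτy : Continuous fun x => tau x y := hτ.comp (by fun_prop : Continuous fun x : Y => (x, y))
  set ρ := density (ν : Measure Y) M' with hρ
  have hρm : Measurable ρ := measurable_density _ _
  have hρ₀ : ∀ x, 0 ≤ ρ x := density_nonneg _ _
  have hρi : Integrable ρ M' := Measure.integrable_toReal_rnDeriv
  have hZ : ∫ x, ρ x ∂M' = 1 := by
    have := Measure.integral_toReal_rnDeriv hent.1
    simpa [hρ, density] using this
  have H : IsEntropyDensity M' ρ := ⟨hρm, hρ₀, hρi, hent.2, by rw [hZ]; exact one_pos⟩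
  have hνeq : H.prob = ν := by
    refine Subtype.ext ?_
    change (H.prob : Measure Y) = ν
    rw [H.coe_prob, hZ]
    conv_rhs => rw [← Measure.withDensity_rnDeriv_eq (ν : Measure Y) M' hent.1]
    refine withDensity_congr_ae ?_
    filter_upwards [Measure.rnDeriv_lt_top (ν : Measure Y) M'] with x hx
    rw [div_one, hρ, density, ENNReal.ofReal_toReal hx.ne]
  have hgood : ∀ᵐ x ∂M', ρ x ≠ 0 → x ∈ C' ∧ 0 < tau x y := by
    have h1 : ∀ᵐ x ∂(ν : Measure Y), x ∈ C' ∧ 0 < tau x y := by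
      have h2 : ∀ᵐ x ∂(ν : Measure Y), x ∈ C' := hν
      filter_upwards [h2, hchron] with x hx hx' using ⟨hx, (tau_pos_iff _ _).2 hx'⟩
    rw [← Measure.withDensity_rnDeriv_eq (ν : Measure Y) M' hent.1,
      ae_withDensity_iff (Measure.measurable_rnDeriv _ _)] at h1
    filter_upwards [h1] with x hx hx'
    refine hx fun h0 => hx' ?_
    simp [hρ, density, h0]
  -- Chronology holds only almost everywhere and without a uniform margin; bounding `τ` below gives
  -- compact sets on which it holds everywhere, and they exhaust the measure.
  let K : ℕ → Set Y := fun k => C' ∩ {x | ((k : ℝ≥0∞) + 1)⁻¹ ≤ tau x y}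
  have hK : ∀ k, IsCompact (K k) := fun k =>
    hC'.inter_right (isClosed_le continuous_const hτy)
  let h : ℕ → Y → ℝ := fun k => (K k).indicator fun x => min (ρ x) (k + 1)
  have hle : ∀ k x, h k x ≤ ρ x := fun k x => by
    by_cases hx : x ∈ K k
    · simp [h, hx]
    · simpa [h, hx] using hρ₀ x
  have hmin₀ : ∀ (k : ℕ) x, 0 ≤ min (ρ x) ((k : ℝ) + 1) := fun k x =>
    le_min (hρ₀ x) (by positivity)
  rw [← hνeq]
  refine H.mem_of_dominated (h := h) (g₁ := ρ) (g₂ := fun x => |ρ x * Real.log (ρ x)|)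
    (fun k => (hρm.min measurable_const).indicator (hK k).measurableSet)
    (fun k x => indicator_nonneg (fun x _ => hmin₀ k x) x) hρi hent.2.abs
    (fun k => Eventually.of_forall (hle k)) (fun k => Eventually.of_forall fun x => ?_) ?_
    isClosed_closure (fun k Hk => ?_)
  · by_cases hx : x ∈ K k
    · have : h k x = min (ρ x) (k + 1) := indicator_of_mem hx _
      rw [this]
      -- The cap is `k + 1` rather than `k`: where it acts, both arguments are at least `1`, and `r
      -- log r` is nonnegative and increasing there, so `ρ log ρ` dominates.
      rcases le_total (ρ x) (k + 1) with h1 | h1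
      · rw [min_eq_left h1]
      · rw [min_eq_right h1]
        have hk1 : (1 : ℝ) ≤ (k : ℝ) + 1 := by linarith [(Nat.cast_nonneg k : (0 : ℝ) ≤ k)]
        have h2 := Real.log_nonneg hk1
        have h3 := Real.log_le_log (by linarith) h1
        rw [abs_of_nonneg (by positivity), abs_of_nonneg (mul_nonneg (hρ₀ x) (h2.trans h3))]
        exact mul_le_mul h1 h3 h2 (hρ₀ x)
    · have : h k x = 0 := indicator_of_notMem hx _
      rw [this, zero_mul, abs_zero]
      exact abs_nonneg _
  · filter_upwards [hgood] with x hx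
    by_cases h0 : ρ x = 0
    · have : ∀ k, h k x = ρ x := fun k => by
        refine le_antisymm (hle k x) ?_
        rw [h0]
        exact indicator_nonneg (fun x _ => hmin₀ k x) x
      simp only [this]
      exact tendsto_const_nhds
    · obtain ⟨hxC, hxτ⟩ := hx h0
      refine tendsto_const_nhds.congr' ?_
      have hz : Tendsto (fun i : ℕ => ((i : ℝ≥0∞) + 1)⁻¹) atTop (𝓝 0) := by
        have := (tendsto_add_atTop_iff_nat 1).2 ENNReal.tendsto_inv_nat_nhds_zero
        simpa using this
      filter_upwards [hz.eventually (gt_mem_nhds hxτ), eventually_ge_atTop ⌈ρ x⌉₊] with k hk hk'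
      have hxK : x ∈ K k := ⟨hxC, hk.le⟩
      have h1 : ρ x ≤ (k : ℝ) + 1 := by
        have : ρ x ≤ k := (Nat.le_ceil _).trans (by exact_mod_cast hk')
        linarith
      have h2 : h k x = min (ρ x) (k + 1) := indicator_of_mem hxK _
      rw [h2, min_eq_left h1]
  · refine mem_closure_admissibleSet_of_bounded m hMf hS hMS hM hτ hy hW (hK k)
      (inter_subset_left.trans hC) (fun x hx => lt_of_lt_of_le (by simp) hx.2) (k := (k : ℝ) + 1)
      (fun x => ?_) (fun x hx => indicator_of_notMem hx _) Hk
    by_cases hx : x ∈ K k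
    · have h2 : h k x = min (ρ x) (k + 1) := indicator_of_mem hx _
      exact h2.le.trans (min_le_right _ _)
    · have : h k x = 0 := indicator_of_notMem hx _
      exact this.le.trans (by positivity)

end Approximation

/-! ## Distortion coefficients -/

section Distortion

theorem continuous_genSin (κ : ℝ) : Continuous (genSin κ) := by
  unfold genSin
  split_ifs <;> fun_prop

theorem sqrt_mul_lt_pi {κ θ : ℝ} (hκ : 0 < κ) (h : κ * θ ^ 2 < Real.pi ^ 2) :
    √κ * θ < Real.pi := by
  refine lt_of_pow_lt_pow_left₀ 2 Real.pi_pos.le ?_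
  rwa [mul_pow, Real.sq_sqrt hκ.le]

theorem genSin_pos {κ θ : ℝ} (hθ : 0 < θ) (h : κ * θ ^ 2 < Real.pi ^ 2) : 0 < genSin κ θ := by
  unfold genSin
  split_ifs with h1 h2
  · have := Real.sqrt_pos.2 h1
    exact div_pos (Real.sin_pos_of_pos_of_lt_pi (by positivity) (sqrt_mul_lt_pi h1 h)) this
  · exact hθ
  · have : 0 < √(-κ) := Real.sqrt_pos.2 (by
      have := lt_of_le_of_ne (not_lt.1 h1) h2
      linarith)
    exact div_pos (Real.sinh_pos_iff.2 (by positivity)) this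

theorem mul_sq_lt_of_le_one {κ t θ : ℝ} (ht₀ : 0 ≤ t) (ht₁ : t ≤ 1)
    (h : κ * θ ^ 2 < Real.pi ^ 2) : κ * (t * θ) ^ 2 < Real.pi ^ 2 := by
  have hpi : 0 < Real.pi ^ 2 := by positivity
  have ht : t ^ 2 ≤ 1 := pow_le_one₀ ht₀ ht₁
  have ht' : 0 ≤ t ^ 2 := by positivity
  rw [mul_pow, mul_left_comm]
  rcases le_total (κ * θ ^ 2) 0 with h0 | h0 <;> nlinarith

theorem distortion_eq_ofReal {κ t θ : ℝ} (hθ : 0 < θ) (h : κ * θ ^ 2 < Real.pi ^ 2) :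
    distortion κ t θ = ENNReal.ofReal (genSin κ (t * θ) / genSin κ θ) := by
  unfold distortion
  split_ifs with h1
  · have h0 : κ = 0 := by
      rcases mul_eq_zero.1 h1 with h | h
      · exact h
      · exact absurd h (by positivity)
    subst h0
    simp [genSin, hθ.ne']
  · rfl

theorem distortion_eq_top {κ t θ : ℝ} (h : Real.pi ^ 2 ≤ κ * θ ^ 2) : distortion κ t θ = ∞ := by
  have hpi : 0 < Real.pi ^ 2 := by positivity
  rw [distortion, if_neg (by linarith), if_neg (not_lt.2 h)]

theorem distortion_pos {κ t θ : ℝ} (ht₀ : 0 < t) (ht₁ : t ≤ 1) (hθ : 0 < θ) :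
    0 < distortion κ t θ := by
  rcases lt_or_ge (κ * θ ^ 2) (Real.pi ^ 2) with h | h
  · rw [distortion_eq_ofReal hθ h, ENNReal.ofReal_pos]
    exact div_pos (genSin_pos (by positivity) (mul_sq_lt_of_le_one ht₀.le ht₁ h)) (genSin_pos hθ h)
  · rw [distortion_eq_top h]
    exact ENNReal.zero_lt_top

/-- If the distortion coefficients at the midpoint stay bounded, the limit is subcritical. -/
theorem mul_sq_lt_of_tendsto {α : Type*} {l : Filter α} [l.NeBot] {κ b θ : ℝ} {θ' : α → ℝ}
    (hθ : 0 < θ) (hlim : Tendsto θ' l (𝓝 θ))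
    (h : ∀ᶠ a in l, κ * θ' a ^ 2 < Real.pi ^ 2 ∧
      genSin κ (1 / 2 * θ' a) / genSin κ (θ' a) ≤ b) :
    κ * θ ^ 2 < Real.pi ^ 2 := by
  have hle : κ * θ ^ 2 ≤ Real.pi ^ 2 :=
    le_of_tendsto ((hlim.pow 2).const_mul κ) (h.mono fun a ha => ha.1.le)
  refine lt_of_le_of_ne hle fun heq => ?_
  have hκ : 0 < κ := by
    by_contra hκ
    have : 0 < Real.pi ^ 2 := by positivity
    nlinarith [sq_nonneg θ, not_lt.1 hκ]
  have hs : √κ * θ = Real.pi := by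
    have h1 : (√κ * θ) ^ 2 = Real.pi ^ 2 := by rw [mul_pow, Real.sq_sqrt hκ.le, heq]
    exact (pow_left_inj₀ (by positivity) Real.pi_pos.le two_ne_zero).1 h1
  -- At the critical value the denominator of the coefficient vanishes while the numerator,
  -- evaluated at half the argument, stays positive; this contradicts the bound `b`.
  have h0 : genSin κ θ = 0 := by simp [genSin, hκ, hs]
  have h1 : 0 < genSin κ (1 / 2 * θ) := by
    refine genSin_pos (by positivity) ?_
    have : 0 < Real.pi ^ 2 := by positivity
    nlinarith
  have hb : ∀ᶠ a in l, genSin κ (1 / 2 * θ' a) ≤ b * genSin κ (θ' a) := by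
    filter_upwards [h, hlim.eventually (lt_mem_nhds hθ)] with a ha ha'
    exact (div_le_iff₀ (genSin_pos ha' ha.1)).1 ha.2
  have h2 : Tendsto (fun a => genSin κ (1 / 2 * θ' a)) l (𝓝 (genSin κ (1 / 2 * θ))) :=
    ((continuous_genSin κ).tendsto _).comp (hlim.const_mul _)
  have h3 : Tendsto (fun a => b * genSin κ (θ' a)) l (𝓝 (b * genSin κ θ)) :=
    (((continuous_genSin κ).tendsto _).comp hlim).const_mul _
  have := le_of_tendsto_of_tendsto h2 h3 hb
  rw [h0, mul_zero] at this
  linarith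

end Distortion

/-! ## Stability inside a fixed ambient space -/

section Stability

open CausalSpace LorentzianPreLengthSpace

variable {Y : Type*} [MetricSpace Y] [MeasurableSpace Y] [BorelSpace Y]
  [LorentzianPreLengthSpace Y]

/-- The timelike measure contraction property for a reference measure `M` living on `S`. -/
def ContractsOn (p K N : ℝ) (M : Measure Y) (S : Set Y) : Prop :=
  ∀ (C : Set Y) (ν : ProbabilityMeasure Y) (y : Y), IsAdmissible M S C ν y →
    ∃ μ : Icc (0 : ℝ) 1 → ProbabilityMeasure Y,
      IsEllPGeodesic p μ ∧ μ 0 = ν ∧ (μ 1 : Measure Y) = Measure.dirac y ∧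
      ∀ t : Icc (0 : ℝ) 1, t < 1 →
        distortion (K / N) (1 - t) (tauNorm (ν : Measure Y) y) * entropicU N ν M ≤
          entropicU N (μ t : Measure Y) M

/-- Positivity of `ℓ_p` provides some causal coupling from time `0` to `t` and from `t` to `1`. Its
marginals place `μ t` in the future of `C` and in the past of `B`. -/
theorem geodesic_measure_compl_eq_zero (hJ : IsClosed {z : Y × Y | causal z.1 z.2}) {p : ℝ}
    {μ : Icc (0 : ℝ) 1 → ProbabilityMeasure Y} (hμ : IsEllPGeodesic p μ) {C B : Set Y}
    (hC : IsCompact C) (hB : IsCompact B) (h0 : (μ 0 : Measure Y) Cᶜ = 0) {y : Y} (hy : y ∈ B)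
    (h1 : (μ 1 : Measure Y) = Measure.dirac y) (t : Icc (0 : ℝ) 1) :
    (μ t : Measure Y) (causalFuture C ∩ causalPast B)ᶜ = 0 := by
  have hcoup : ∀ s t : Icc (0 : ℝ) 1, s ≤ t →
      ∃ π : Measure (Y × Y), IsCausalCoupling π (μ s : Measure Y) (μ t) := by
    intro s t hst
    rcases hst.eq_or_lt with rfl | hst
    · exact ⟨_, isCausalCoupling_diag hJ _⟩
    · obtain ⟨π, hπ, -⟩ := exists_coupling_of_lt_ellP (c := 0) (hμ s t hst).2.1
      exact ⟨π, hπ⟩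
  have hF : ∀ᵐ x ∂(μ t : Measure Y), x ∈ causalFuture C := by
    obtain ⟨π, hπ⟩ := hcoup 0 t t.2.1
    rw [← hπ.map_snd]
    refine (ae_map_iff measurable_snd.aemeasurable
      (isClosed_causalFuture hJ hC).measurableSet).2 ?_
    have h2 : ∀ᵐ z ∂π, z.1 ∈ C := by
      refine (ae_map_iff measurable_fst.aemeasurable hC.measurableSet).1 ?_
      rw [hπ.map_fst]
      exact h0
    filter_upwards [h2, hπ.ae_causal] with z hz hz' using ⟨z.1, hz, hz'⟩
  have hP : ∀ᵐ x ∂(μ t : Measure Y), x ∈ causalPast B := by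
    obtain ⟨π, hπ⟩ := hcoup t 1 t.2.2
    rw [← hπ.map_fst]
    refine (ae_map_iff measurable_fst.aemeasurable
      (isClosed_causalPast hJ hB).measurableSet).2 ?_
    have h2 : ∀ᵐ z ∂π, z.2 ∈ B := by
      refine (ae_map_iff measurable_snd.aemeasurable hB.measurableSet).1 ?_
      rw [hπ.map_snd, h1]
      exact (ae_dirac_iff hB.measurableSet).2 hy
    filter_upwards [h2, hπ.ae_causal] with z hz hz' using ⟨z.2, hz, hz'⟩
  have : ∀ᵐ x ∂(μ t : Measure Y), x ∈ causalFuture C ∩ causalPast B := by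
    filter_upwards [hF, hP] with x h1 h2 using ⟨h1, h2⟩
  exact this

theorem timeCost_prod_dirac (hτ : Continuous fun z : Y × Y => tau z.1 z.2) (q : ℝ)
    (ν : Measure Y) [IsProbabilityMeasure ν] (y : Y) :
    timeCost q (ν.prod (Measure.dirac y)) = ∫⁻ x, tau x y ^ q ∂ν := by
  have hm : Measurable fun z : Y × Y => tau z.1 z.2 ^ q := hτ.measurable.pow_const q
  rw [timeCost, lintegral_prod _ hm.aemeasurable]
  refine lintegral_congr fun x => ?_
  exact lintegral_dirac' y (hm.comp (by fun_prop : Measurable fun w : Y => (x, w)))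

/-- Viewing the integral as the cost of the product with a Dirac mass turns the moving target into
weak convergence of product measures. -/
theorem tendsto_lintegral_tau_rpow (hτ : Continuous fun z : Y × Y => tau z.1 z.2)
    (hfin : ∀ x y : Y, tau x y ≠ ∞) {q : ℝ} (hq : 0 ≤ q) {α : Type*} {l : Filter α} [l.NeBot]
    {ν : α → ProbabilityMeasure Y} {ν' : ProbabilityMeasure Y} (hν : Tendsto ν l (𝓝 ν'))
    {y : α → Y} {y' : Y} (hy : Tendsto y l (𝓝 y')) {C B : Set Y} (hC : IsCompact C)
    (hB : IsCompact B) (hνC : ∀ᶠ a in l, (ν a : Measure Y) Cᶜ = 0) (hyB : ∀ᶠ a in l, y a ∈ B) :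
    Tendsto (fun a => ∫⁻ x, tau x (y a) ^ q ∂(ν a : Measure Y)) l
      (𝓝 (∫⁻ x, tau x y' ^ q ∂(ν' : Measure Y))) := by
  have h1 : Tendsto (fun a => diracProba (y a)) l (𝓝 (diracProba y')) :=
    (continuous_diracProba.tendsto _).comp hy
  have h2 : Tendsto (fun a => (ν a).prod (diracProba (y a))) l (𝓝 (ν'.prod (diracProba y'))) :=
    (ProbabilityMeasure.continuous_prod.tendsto (ν', diracProba y')).comp (hν.prodMk_nhds h1)
  have h3 := tendsto_timeCost hτ hfin hq h2 (hC.prod hB) (by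
    filter_upwards [hνC, hyB] with a ha hb
    have : ∀ᵐ z ∂((ν a : Measure Y).prod (Measure.dirac (y a))), z.1 ∈ C ∧ z.2 ∈ B := by
      have e1 : ∀ᵐ z ∂((ν a : Measure Y).prod (Measure.dirac (y a))), z.1 ∈ C :=
        Measure.quasiMeasurePreserving_fst.ae (p := fun x => x ∈ C) ha
      have e2 : ∀ᵐ z ∂((ν a : Measure Y).prod (Measure.dirac (y a))), z.2 ∈ B :=
        Measure.quasiMeasurePreserving_snd.ae (p := fun x => x ∈ B)
          ((ae_dirac_iff hB.measurableSet).2 hb)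
      filter_upwards [e1, e2] with z hz hz' using ⟨hz, hz'⟩
    exact this)
  have e : ∀ (κ : ProbabilityMeasure Y) (w : Y),
      timeCost q ((κ.prod (diracProba w) : ProbabilityMeasure (Y × Y)) : Measure (Y × Y)) =
        ∫⁻ x, tau x w ^ q ∂(κ : Measure Y) := fun κ w => timeCost_prod_dirac hτ q _ w
  simpa only [e] using h3

theorem lintegral_tau_rpow_ne_top (hτ : Continuous fun z : Y × Y => tau z.1 z.2)
    (hfin : ∀ x y : Y, tau x y ≠ ∞) {q : ℝ} (hq : 0 ≤ q) {ν : Measure Y} [IsProbabilityMeasure ν]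
    {C : Set Y} (hC : IsCompact C) (hν : ν Cᶜ = 0) (y : Y) :
    ∫⁻ x, tau x y ^ q ∂ν ≠ ∞ := by
  have hτy : Continuous fun x => tau x y ^ q :=
    (ENNReal.continuous_rpow_const).comp
      (hτ.comp (by fun_prop : Continuous fun x : Y => (x, y)))
  obtain ⟨c, hc, hcC⟩ : ∃ c : ℝ≥0∞, c ≠ ∞ ∧ ∀ x ∈ C, tau x y ^ q ≤ c := by
    rcases C.eq_empty_or_nonempty with rfl | hne
    · exact ⟨0, ENNReal.zero_ne_top, fun x hx => absurd hx (notMem_empty x)⟩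
    · obtain ⟨x₀, -, hx₀⟩ := hC.exists_isMaxOn hne hτy.continuousOn
      exact ⟨tau x₀ y ^ q, ENNReal.rpow_ne_top_of_nonneg hq (hfin _ _), fun x hx => hx₀ hx⟩
  have hae : ∀ᵐ x ∂ν, x ∈ C := hν
  refine ne_top_of_le_ne_top hc ?_
  calc ∫⁻ x, tau x y ^ q ∂ν ≤ ∫⁻ _, c ∂ν := lintegral_mono_ae (hae.mono hcC)
    _ = c := by simp

theorem lintegral_tau_rpow_ne_zero (hτ : Continuous fun z : Y × Y => tau z.1 z.2) {q : ℝ}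
    (hq : 0 ≤ q) {ν : Measure Y} [IsProbabilityMeasure ν] {y : Y} (h : ∀ᵐ x ∂ν, chron x y) :
    ∫⁻ x, tau x y ^ q ∂ν ≠ 0 := by
  have hτy : Measurable fun x => tau x y ^ q :=
    ((hτ.comp (by fun_prop : Continuous fun x : Y => (x, y))).measurable).pow_const q
  rw [Ne, lintegral_eq_zero_iff hτy]
  intro h0
  have : ∀ᵐ x ∂ν, False := by
    filter_upwards [h0, h] with x hx hx'
    have h1 := (tau_pos_iff x y).2 hx'
    rw [Pi.zero_apply, ENNReal.rpow_eq_zero_iff] at hx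
    rcases hx with ⟨h2, -⟩ | ⟨-, h2⟩
    · exact h1.ne' h2
    · linarith
  simp only [eventually_false_iff_eq_bot, ae_eq_bot] at this
  exact IsProbabilityMeasure.ne_zero ν this

theorem tauNorm_eq (ν : Measure Y) (y : Y) :
    tauNorm ν y = ((∫⁻ x, tau x y ^ (2 : ℝ) ∂ν) ^ (1 / 2 : ℝ)).toReal := by
  simp [tauNorm]

end Stability

/-! ### Passage to the limit of the contraction geodesics. -/

section StabilityTheorem

open CausalSpace LorentzianPreLengthSpace

variable {Y : Type*} [MetricSpace Y] [MeasurableSpace Y] [BorelSpace Y]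
  [LorentzianPreLengthSpace Y]

theorem Lorentz.IsEllPGeodesic.ellP_eq {p : ℝ} {μ : Icc (0 : ℝ) 1 → ProbabilityMeasure Y}
    (h : IsEllPGeodesic p μ) {L : ℝ≥0∞} (hL : ellP p (μ 0 : Measure Y) (μ 1) = (L : EReal))
    {s t : Icc (0 : ℝ) 1} (hst : s < t) :
    ellP p (μ s : Measure Y) (μ t) = ((ENNReal.ofReal ((t : ℝ) - s) * L : ℝ≥0∞) : EReal) := by
  have hst' : (0 : ℝ) < (t : ℝ) - s := sub_pos.2 hst
  rw [(h s t hst).1, hL, EReal.coe_ennreal_mul, EReal.coe_ennreal_ofReal, max_eq_left hst'.le]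

/-- A weak limit of geodesics ending in Dirac masses is a geodesic. -/
theorem isEllPGeodesic_of_tendsto (hJ : IsClosed {z : Y × Y | causal z.1 z.2})
    (hτ : Continuous fun z : Y × Y => tau z.1 z.2) (hfin : ∀ x y : Y, tau x y ≠ ∞)
    {p : ℝ} (hp₀ : 0 < p) (hp₁ : p < 1) {α : Type*} (u : Ultrafilter α)
    {μ : α → Icc (0 : ℝ) 1 → ProbabilityMeasure Y} {μ' : Icc (0 : ℝ) 1 → ProbabilityMeasure Y}
    (hμ : ∀ t, Tendsto (fun a => μ a t) u (𝓝 (μ' t))) {y : α → Y} {y' : Y}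
    (hy : Tendsto y u (𝓝 y')) {n : α → ℕ} (hn : Tendsto n u atTop)
    (hgeo : ∀ᶠ a in (u : Filter α), IsEllPGeodesic p (μ a))
    (hdirac : ∀ᶠ a in (u : Filter α), (μ a 1 : Measure Y) = Measure.dirac (y a))
    (hchron : ∀ᶠ a in (u : Filter α), ∀ᵐ x ∂(μ a 0 : Measure Y), chron x (y a))
    (hchron' : ∀ᵐ x ∂(μ' 0 : Measure Y), chron x y') {D : Set Y} (hD : IsCompact D)
    (hμD : ∀ᶠ a in (u : Filter α), ∀ t, (μ a t : Measure Y) Dᶜ = 0)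
    (hyD : ∀ᶠ a in (u : Filter α), y a ∈ D) :
    (μ' 1 : Measure Y) = Measure.dirac y' ∧ IsEllPGeodesic p μ' := by
  have hp' : 0 < 1 / p := by positivity
  have hμ1 : μ' 1 = diracProba y' := by
    refine tendsto_nhds_unique (hμ 1) (((continuous_diracProba.tendsto _).comp hy).congr' ?_)
    filter_upwards [hdirac] with a ha
    exact Subtype.ext ha.symm
  have hμ1' : (μ' 1 : Measure Y) = Measure.dirac y' := by rw [hμ1]; rfl
  refine ⟨hμ1', ?_⟩
  let I : α → ℝ≥0∞ := fun a => ∫⁻ x, tau x (y a) ^ p ∂(μ a 0 : Measure Y)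
  have hI : Tendsto I u (𝓝 (∫⁻ x, tau x y' ^ p ∂(μ' 0 : Measure Y))) :=
    tendsto_lintegral_tau_rpow hτ hfin hp₀.le (hμ 0) hy hD hD (hμD.mono fun a ha => ha 0) hyD
  have hμ'D : (μ' 0 : Measure Y) Dᶜ = 0 :=
    measure_compl_eq_zero_of_tendsto (hμ 0) hD.isClosed (hμD.mono fun a ha => ha 0)
  set L := (∫⁻ x, tau x y' ^ p ∂(μ' 0 : Measure Y)) ^ (1 / p) with hL
  have hLlim : Tendsto (fun a => I a ^ (1 / p)) u (𝓝 L) :=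
    (ENNReal.continuous_rpow_const.tendsto _).comp hI
  have hL₁ : L ≠ ∞ := ENNReal.rpow_ne_top_of_nonneg hp'.le
    (lintegral_tau_rpow_ne_top hτ hfin hp₀.le hD hμ'D y')
  have hL₀ : L ≠ 0 := by
    rw [hL, Ne, ENNReal.rpow_eq_zero_iff]
    rintro (⟨h, -⟩ | ⟨-, h⟩)
    · exact lintegral_tau_rpow_ne_zero hτ hp₀.le hchron' h
    · linarith
  refine isEllPGeodesic_of_couplings hJ hτ hp₀ hp₁ hμ1' hL.symm hL₀ hL₁ fun s t hst => ?_
  have hst' : (0 : ℝ) < (t : ℝ) - s := sub_pos.2 hst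
  -- Couplings within a factor `r a < 1` of the supremum are used, so that attainment of `ℓ_p` is
  -- not needed; the factor tends to `1` because the index `n a` tends to infinity.
  let r : α → ℝ≥0∞ := fun a => ENNReal.ofReal ((n a : ℝ) / (n a + 1))
  have hr : Tendsto r u (𝓝 1) := by
    have := ((tendsto_natCast_div_add_atTop (𝕜 := ℝ) 1).comp hn)
    simpa [r, Function.comp_def] using (ENNReal.continuous_ofReal.tendsto _).comp this
  have hr1 : ∀ a, r a < 1 := fun a => by
    have h1 : (0 : ℝ) < (n a : ℝ) + 1 := by positivity
    rw [← ENNReal.ofReal_one, ENNReal.ofReal_lt_ofReal_iff one_pos, div_lt_one h1]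
    linarith
  have hb : Tendsto (fun a => (r a * (ENNReal.ofReal ((t : ℝ) - s) * I a ^ (1 / p))) ^ p) u
      (𝓝 ((ENNReal.ofReal ((t : ℝ) - s) * L) ^ p)) := by
    refine (ENNReal.continuous_rpow_const.tendsto _).comp ?_
    have h1 := ENNReal.Tendsto.const_mul (a := ENNReal.ofReal ((t : ℝ) - s)) hLlim
      (Or.inr ENNReal.ofReal_ne_top)
    have h2 := ENNReal.Tendsto.mul hr (Or.inl one_ne_zero) h1 (Or.inr ENNReal.one_ne_top)
    rwa [one_mul] at h2
  refine exists_limit_coupling hJ hτ hfin hp₀.le u (hμ s) (hμ t) hD (hμD.mono fun a ha => ha s)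
    (hμD.mono fun a ha => ha t) hb ?_
  filter_upwards [hgeo, hdirac, hchron] with a h1 h2 h3
  have hell : ellP p (μ a 0 : Measure Y) (μ a 1) = ((I a ^ (1 / p) : ℝ≥0∞) : EReal) := by
    rw [h2]
    exact ellP_dirac hJ hτ (h3.mono fun x hx => causal_of_chron _ _ hx)
  have hell' := h1.ellP_eq hell hst
  obtain ⟨-, g1, g2⟩ := h1 s t hst
  rw [hell'] at g1 g2
  have g1' : ENNReal.ofReal ((t : ℝ) - s) * I a ^ (1 / p) ≠ 0 := by
    intro h0
    rw [h0] at g1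
    simp at g1
  have g2' : ENNReal.ofReal ((t : ℝ) - s) * I a ^ (1 / p) ≠ ∞ := by
    intro h0
    rw [h0] at g2
    simp at g2
  obtain ⟨π, hπ, hlt⟩ := exists_coupling_of_lt_ellP
    (c := r a * (ENNReal.ofReal ((t : ℝ) - s) * I a ^ (1 / p))) (μ := (μ a s : Measure Y))
    (ν := (μ a t : Measure Y)) (p := p) (by
      rw [hell', EReal.coe_ennreal_lt_coe_ennreal_iff]
      conv_rhs => rw [← one_mul (ENNReal.ofReal ((t : ℝ) - s) * I a ^ (1 / p))]
      exact ENNReal.mul_lt_mul_left g1' g2' (hr1 a))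
  refine ⟨π, hπ, ?_⟩
  have := ENNReal.rpow_le_rpow hlt.le hp₀.le
  rwa [← ENNReal.rpow_mul (timeCost p π), one_div_mul_cancel hp₀.ne', ENNReal.rpow_one] at this

/-- The dual inequality with `φ = 0` bounds minus the entropy by `∫ χ exp (-1)`, which converges
along `l`. -/
theorem exists_entReal_lower_bound {α : Type*} {l : Filter α} {M : α → Measure Y} {M' : Measure Y}
    (hMfin : ∀ a, IsFiniteMeasureOnCompacts (M a))
    (hM : ∀ φ : Y → ℝ, Continuous φ → HasCompactSupport φ →
      Tendsto (fun a => ∫ y, φ y ∂(M a)) l (𝓝 (∫ y, φ y ∂M')))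
    {D : Set Y} (hD : IsCompact D) :
    ∃ c : ℝ, ∀ᶠ a in l, ∀ ν : ProbabilityMeasure Y, (ν : Measure Y) Dᶜ = 0 →
      FiniteEntropy (ν : Measure Y) (M a) → -c ≤ entReal (ν : Measure Y) (M a) := by
  obtain ⟨χ, hχ1, -, hχc, hχ01⟩ := exists_continuous_one_zero_of_isCompact hD isClosed_empty
    (disjoint_empty D)
  have hlim := hM (fun x => χ x * Real.exp (0 - 1)) (by fun_prop) hχc.mul_right
  refine ⟨(∫ y, χ y * Real.exp (0 - 1) ∂M') + 1, ?_⟩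
  filter_upwards [hlim.eventually (gt_mem_nhds (lt_add_one _))] with a ha ν hν hent
  have := hMfin a
  have h := integral_le_entReal_add hent χ.continuous hχc (fun x => (hχ01 x).1) hD.measurableSet
    (fun x hx => hχ1 hx) hν 0
  simp only [BoundedContinuousFunction.coe_zero, Pi.zero_apply, integral_zero] at h
  linarith

theorem FiniteEntropy.mul_exp_le {M : Measure Y} {μ ν : Measure Y} {N r : ℝ} (hr : 0 ≤ r)
    (hμ : FiniteEntropy μ M) (hν : FiniteEntropy ν M)
    (h : ENNReal.ofReal r * entropicU N ν M ≤ entropicU N μ M) :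
    r * Real.exp (-entReal ν M / N) ≤ Real.exp (-entReal μ M / N) := by
  rw [hμ.entropicU_eq, hν.entropicU_eq, ← ENNReal.ofReal_mul hr,
    ENNReal.ofReal_le_ofReal_iff (Real.exp_nonneg _)] at h
  exact h

/-- Entropy `+∞` would make the right-hand `U_N` zero, against a positive left side; `-∞` is
excluded by concentration on a compact set. -/
theorem finiteEntropy_of_mul_le {M : Measure Y} [IsFiniteMeasureOnCompacts M] {μ ν : Measure Y}
    [IsFiniteMeasure μ] {N : ℝ} (hN : 0 < N) {r : ℝ≥0∞} (hr : 0 < r) (hν : FiniteEntropy ν M)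
    {D : Set Y} (hD : IsCompact D) (hμ : μ Dᶜ = 0)
    (h : r * entropicU N ν M ≤ entropicU N μ M) : FiniteEntropy μ M := by
  refine finiteEntropy_of_ne_top (fun htop => ?_) hD.measurableSet hμ hD.measure_lt_top
  have h1 : entropicU N μ M = 0 := by
    rw [entropicU, htop, EReal.neg_top, EReal.bot_div_of_pos_ne_top (by exact_mod_cast hN)
      (EReal.coe_ne_top _), EReal.exp_bot]
  rw [h1, hν.entropicU_eq] at h
  have h2 : 0 < r * ENNReal.ofReal (Real.exp (-entReal ν M / N)) :=
    ENNReal.mul_pos hr.ne' (by simpa using Real.exp_pos _)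
  exact absurd h (not_le.2 h2)

/-- Stability of the contraction property under vague convergence of the reference measures. -/
theorem exists_contraction_of_tendsto
    (hJ : IsClosed {z : Y × Y | causal z.1 z.2})
    (hdiam : ∀ K₁ K₂ : Set Y, IsCompact K₁ → IsCompact K₂ →
      IsCompact (causalFuture K₁ ∩ causalPast K₂))
    (hτ : Continuous fun z : Y × Y => tau z.1 z.2) (hfin : ∀ x y : Y, tau x y ≠ ∞)
    {p K N : ℝ} (hp₀ : 0 < p) (hp₁ : p < 1) (hN : 0 < N)
    {M : ℕ → Measure Y} {M' : Measure Y} {S : ℕ → Set Y}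
    (hMf : ∀ n, IsFiniteMeasureOnCompacts (M n)) [IsFiniteMeasureOnCompacts M']
    (hS : ∀ n, IsSigmaCompact (S n)) (hMS : ∀ n, M n (S n)ᶜ = 0)
    (hM : ∀ φ : Y → ℝ, Continuous φ → HasCompactSupport φ →
      Tendsto (fun n => ∫ y, φ y ∂(M n)) atTop (𝓝 (∫ y, φ y ∂M')))
    (hTMCP : ∀ n, ContractsOn p K N (M n) (S n))
    {ν : ProbabilityMeasure Y} {C' : Set Y} (hC' : IsCompact C') (hν : (ν : Measure Y) C'ᶜ = 0)
    (hent : FiniteEntropy (ν : Measure Y) M') {y : Y} (hy : ∀ U ∈ 𝓝 y, 0 < M' U)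
    (hchron : ∀ᵐ x ∂(ν : Measure Y), chron x y) :
    ∃ μ : Icc (0 : ℝ) 1 → ProbabilityMeasure Y,
      IsEllPGeodesic p μ ∧ μ 0 = ν ∧ (μ 1 : Measure Y) = Measure.dirac y ∧
      ∀ t : Icc (0 : ℝ) 1, t < 1 → FiniteEntropy (μ t : Measure Y) M' ∧
        distortion (K / N) (1 - t) (tauNorm (ν : Measure Y) y) * entropicU N ν M' ≤
          entropicU N (μ t : Measure Y) M' := by
  -- The approximating measures may spread beyond `C'`, but all of them remain in one compact
  -- neighbourhood.
  obtain ⟨C, hC, hCC⟩ := exists_compact_superset hC'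
  set e := entReal (ν : Measure Y) M' with he
  let good : Set (ℕ × (ProbabilityMeasure Y × ℝ) × Y) :=
    {a | IsAdmissible (M a.1) (S a.1) C a.2.1.1 a.2.2 ∧
      entReal (a.2.1.1 : Measure Y) (M a.1) = a.2.1.2}
  -- Density of admissible data says that this filter on triples of index, measure with entropy, and
  -- target is proper. An ultrafilter below it makes all the required convergences hold along one
  -- limit.
  have hne : ((atTop ×ˢ (𝓝 (ν, e) ×ˢ 𝓝 y)) ⊓ 𝓟 good).NeBot := by
    rw [inf_principal_neBot_iff]
    intro U hU
    obtain ⟨U₁, hU₁, V, hV, hUV⟩ := mem_prod_iff.1 hU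
    obtain ⟨U₂, hU₂, W, hW, hUW⟩ := mem_prod_iff.1 hV
    obtain ⟨m, hm⟩ := mem_atTop_sets.1 hU₁
    have hcl := mem_closure_admissibleSet m hMf hS hMS hM hτ hy hW hC' hCC hν hent hchron
    obtain ⟨q, hqU, n, hmn, w, hw, hadm, hq⟩ := mem_closure_iff_nhds.1 hcl U₂ hU₂
    exact ⟨(n, q, w), hUV (mk_mem_prod (hm n hmn) (hUW (mk_mem_prod hqU hw))), hadm, hq⟩
  let u := Ultrafilter.of ((atTop ×ˢ (𝓝 (ν, e) ×ˢ 𝓝 y)) ⊓ 𝓟 good)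
  have hu := Ultrafilter.of_le ((atTop ×ˢ (𝓝 (ν, e) ×ˢ 𝓝 y)) ⊓ 𝓟 good)
  have hu1 : (u : Filter (ℕ × (ProbabilityMeasure Y × ℝ) × Y)) ≤ atTop ×ˢ (𝓝 (ν, e) ×ˢ 𝓝 y) := hu.trans inf_le_left
  have hgood : ∀ᶠ a in (u : Filter (ℕ × (ProbabilityMeasure Y × ℝ) × Y)), a ∈ good := hu (mem_inf_of_right (mem_principal_self _))
  have hn : Tendsto (fun a : ℕ × (ProbabilityMeasure Y × ℝ) × Y => a.1) u atTop :=
    tendsto_fst.mono_left hu1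
  have hq : Tendsto (fun a : ℕ × (ProbabilityMeasure Y × ℝ) × Y => a.2.1) u (𝓝 (ν, e)) :=
    (tendsto_fst.comp tendsto_snd).mono_left hu1
  have hylim : Tendsto (fun a : ℕ × (ProbabilityMeasure Y × ℝ) × Y => a.2.2) u (𝓝 y) :=
    (tendsto_snd.comp tendsto_snd).mono_left hu1
  have hνlim : Tendsto (fun a : ℕ × (ProbabilityMeasure Y × ℝ) × Y => a.2.1.1) u (𝓝 ν) :=
    (continuous_fst.tendsto _).comp hq
  have helim : Tendsto (fun a : ℕ × (ProbabilityMeasure Y × ℝ) × Y => a.2.1.2) u (𝓝 e) :=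
    (continuous_snd.tendsto (ν, e)).comp hq
  have hex : ∀ a : ℕ × (ProbabilityMeasure Y × ℝ) × Y,
      ∃ μ : Icc (0 : ℝ) 1 → ProbabilityMeasure Y, a ∈ good →
      IsEllPGeodesic p μ ∧ μ 0 = a.2.1.1 ∧ (μ 1 : Measure Y) = Measure.dirac a.2.2 ∧
      ∀ t : Icc (0 : ℝ) 1, t < 1 →
        distortion (K / N) (1 - t) (tauNorm (a.2.1.1 : Measure Y) a.2.2) *
          entropicU N a.2.1.1 (M a.1) ≤ entropicU N (μ t : Measure Y) (M a.1) := by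
    intro a
    by_cases ha : a ∈ good
    · obtain ⟨μ, hμ⟩ := hTMCP a.1 C _ _ ha.1
      exact ⟨μ, fun _ => hμ⟩
    · exact ⟨fun _ => ν, fun h => absurd h ha⟩
  choose μ hμ using hex
  set B := Metric.closedBall y 1 with hBdef
  have hB : IsCompact B := isCompact_closedBall y 1
  have hyB : ∀ᶠ a in (u : Filter (ℕ × (ProbabilityMeasure Y × ℝ) × Y)), a.2.2 ∈ B :=
    hylim.eventually (Metric.closedBall_mem_nhds y one_pos)
  set D := causalFuture C ∩ causalPast B with hDdef
  have hD : IsCompact D := hdiam C B hC hB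
  have hμD : ∀ᶠ a in (u : Filter (ℕ × (ProbabilityMeasure Y × ℝ) × Y)), ∀ t, (μ a t : Measure Y) Dᶜ = 0 := by
    filter_upwards [hgood, hyB] with a ha hya t
    obtain ⟨h1, h2, h3, -⟩ := hμ a ha
    exact geodesic_measure_compl_eq_zero hJ h1 hC hB (by rw [h2]; exact ha.1.measure_compl) hya h3 t
  have hyD : ∀ᶠ a in (u : Filter (ℕ × (ProbabilityMeasure Y × ℝ) × Y)), a.2.2 ∈ D := by
    filter_upwards [hgood, hμD] with a ha haD
    have h1 : ∀ᵐ x ∂(μ a 1 : Measure Y), x ∈ D := haD 1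
    rw [(hμ a ha).2.2.1] at h1
    exact (ae_dirac_iff hD.measurableSet).1 h1
  -- The same ultrafilter serves every `t`, so neither a diagonal extraction nor equicontinuity in
  -- time is needed.
  have hlim : ∀ t, ∃ μ' : ProbabilityMeasure Y, Tendsto (fun a => μ a t) u (𝓝 μ') := fun t =>
    exists_tendsto_of_ultrafilter u hD (hμD.mono fun a ha => ha t)
  choose μ' hμ' using hlim
  have hμ'0 : μ' 0 = ν := by
    refine tendsto_nhds_unique (hμ' 0) (hνlim.congr' ?_)
    filter_upwards [hgood] with a ha using (hμ a ha).2.1.symm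
  obtain ⟨hμ'1, hgeo⟩ := isEllPGeodesic_of_tendsto hJ hτ hfin hp₀ hp₁ u hμ' hylim hn
    (hgood.mono fun a ha => (hμ a ha).1) (hgood.mono fun a ha => (hμ a ha).2.2.1)
    (hgood.mono fun a ha => by rw [(hμ a ha).2.1]; exact ha.1.ae_chron)
    (by rw [hμ'0]; exact hchron) hD hμD hyD
  refine ⟨μ', hgeo, hμ'0, hμ'1, ?_⟩
  set κ := K / N with hκ
  set θ := tauNorm (ν : Measure Y) y with hθdef
  let θ' : ℕ × (ProbabilityMeasure Y × ℝ) × Y → ℝ := fun a => tauNorm (a.2.1.1 : Measure Y) a.2.2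
  have hνI := lintegral_tau_rpow_ne_top hτ hfin (q := 2) zero_le_two hC' hν y
  have hθ₀ : 0 < θ := by
    rw [hθdef, tauNorm_eq]
    refine ENNReal.toReal_pos (fun h => ?_) (ENNReal.rpow_ne_top_of_nonneg (by norm_num) hνI)
    rw [ENNReal.rpow_eq_zero_iff] at h
    rcases h with ⟨h, -⟩ | ⟨-, h⟩
    · exact lintegral_tau_rpow_ne_zero hτ zero_le_two hchron h
    · norm_num at h
  have hθlim : Tendsto θ' u (𝓝 θ) := by
    simp only [θ', hθdef, tauNorm_eq]
    refine (ENNReal.tendsto_toReal (ENNReal.rpow_ne_top_of_nonneg (by norm_num) hνI)).comp ?_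
    refine (ENNReal.continuous_rpow_const.tendsto _).comp ?_
    exact tendsto_lintegral_tau_rpow hτ hfin zero_le_two hνlim hylim hC hB
      (hgood.mono fun a ha => ha.1.measure_compl) hyB
  have hθpos : ∀ᶠ a in (u : Filter (ℕ × (ProbabilityMeasure Y × ℝ) × Y)), 0 < θ' a := hθlim.eventually (lt_mem_nhds hθ₀)
  have hMu : ∀ φ : Y → ℝ, Continuous φ → HasCompactSupport φ →
      Tendsto (fun a : ℕ × (ProbabilityMeasure Y × ℝ) × Y => ∫ y, φ y ∂(M a.1)) u
        (𝓝 (∫ y, φ y ∂M')) := fun φ hφ hφc => (hM φ hφ hφc).comp hn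
  have hfe : ∀ᶠ a in (u : Filter (ℕ × (ProbabilityMeasure Y × ℝ) × Y)), ∀ t : Icc (0 : ℝ) 1, t < 1 →
      FiniteEntropy (μ a t : Measure Y) (M a.1) := by
    filter_upwards [hgood, hμD, hθpos] with a ha haD hθa t ht
    have := hMf a.1
    have ht' : (t : ℝ) < 1 := ht
    exact finiteEntropy_of_mul_le hN (distortion_pos (by linarith) (by linarith [t.2.1]) hθa)
      ha.1.finiteEntropy hD (haD t) ((hμ a ha).2.2.2 t ht)
  have hsub : ∀ᶠ a in (u : Filter (ℕ × (ProbabilityMeasure Y × ℝ) × Y)), κ * θ' a ^ 2 < Real.pi ^ 2 := by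
    filter_upwards [hgood] with a ha
    by_contra hcon
    -- At time `0` an infinite coefficient would bound the finite positive number `U_N` of the
    -- initial measure from below.
    have h1 := (hμ a ha).2.2.2 0 (by exact zero_lt_one)
    rw [distortion_eq_top (not_lt.1 hcon), (hμ a ha).2.1, ha.1.finiteEntropy.entropicU_eq,
      ENNReal.top_mul (by simpa using Real.exp_pos _)] at h1
    exact absurd h1 (not_le.2 ENNReal.ofReal_lt_top)
  have hineq : ∀ t : Icc (0 : ℝ) 1, t < 1 → ∀ᶠ a in (u : Filter (ℕ × (ProbabilityMeasure Y × ℝ) × Y)),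
      0 < genSin κ ((1 - t) * θ' a) / genSin κ (θ' a) ∧
      genSin κ ((1 - t) * θ' a) / genSin κ (θ' a) * Real.exp (-a.2.1.2 / N) ≤
        Real.exp (-entReal (μ a t : Measure Y) (M a.1) / N) := by
    intro t ht
    have ht' : (t : ℝ) < 1 := ht
    filter_upwards [hgood, hθpos, hsub, hfe] with a ha hθa hs hf
    have h1 := (hμ a ha).2.2.2 t ht
    rw [distortion_eq_ofReal hθa hs] at h1
    have hpos : 0 < genSin κ ((1 - t) * θ' a) / genSin κ (θ' a) :=
      div_pos (genSin_pos (mul_pos (by linarith) hθa)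
        (mul_sq_lt_of_le_one (by linarith) (by linarith [t.2.1]) hs)) (genSin_pos hθa hs)
    have h2 := FiniteEntropy.mul_exp_le hpos.le (hf t ht) ha.1.finiteEntropy h1
    rw [ha.2] at h2
    exact ⟨hpos, h2⟩
  obtain ⟨c, hc⟩ := exists_entReal_lower_bound (fun a => hMf _) hMu hD
  have hcrit : κ * θ ^ 2 < Real.pi ^ 2 := by
    -- The bound on the midpoint coefficient combines the lower entropy bound `-c` in the diamond
    -- with the initial entropies, which are eventually below `e + 1`.
    refine mul_sq_lt_of_tendsto (b := Real.exp (c / N) * Real.exp ((e + 1) / N)) hθ₀ hθlim ?_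
    let half : Icc (0 : ℝ) 1 := ⟨1 / 2, by norm_num, by norm_num⟩
    have hhalf : half < 1 := by
      change (1 / 2 : ℝ) < 1
      norm_num
    filter_upwards [hsub, hineq half hhalf, hc, hμD, hfe,
      helim.eventually (gt_mem_nhds (lt_add_one e))] with a h1 h2 h3 h4 h5 h6
    refine ⟨h1, ?_⟩
    have h7 : (1 : ℝ) - (half : ℝ) = 1 / 2 := by
      change (1 : ℝ) - 1 / 2 = 1 / 2
      norm_num
    rw [h7] at h2
    have h8 : Real.exp (-entReal (μ a half : Measure Y) (M a.1) / N) ≤ Real.exp (c / N) := by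
      refine Real.exp_le_exp.2 ((div_le_div_iff_of_pos_right hN).2 ?_)
      linarith [h3 _ (h4 half) (h5 half hhalf)]
    have h9 : Real.exp (a.2.1.2 / N) ≤ Real.exp ((e + 1) / N) :=
      Real.exp_le_exp.2 ((div_le_div_iff_of_pos_right hN).2 h6.le)
    have h10 : Real.exp (-a.2.1.2 / N) * Real.exp (a.2.1.2 / N) = 1 := by
      rw [← Real.exp_add, neg_div, neg_add_cancel, Real.exp_zero]
    calc genSin κ (1 / 2 * θ' a) / genSin κ (θ' a)
        = genSin κ (1 / 2 * θ' a) / genSin κ (θ' a) * Real.exp (-a.2.1.2 / N) *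
            Real.exp (a.2.1.2 / N) := by rw [mul_assoc, h10, mul_one]
      _ ≤ Real.exp (c / N) * Real.exp ((e + 1) / N) :=
          mul_le_mul (h2.2.trans h8) h9 (Real.exp_nonneg _) (Real.exp_nonneg _)
  intro t ht
  have ht' : (t : ℝ) < 1 := ht
  set r := genSin κ ((1 - t) * θ) / genSin κ θ with hr
  have hr₀ : 0 < r := div_pos (genSin_pos (mul_pos (by linarith) hθ₀)
    (mul_sq_lt_of_le_one (by linarith) (by linarith [t.2.1]) hcrit)) (genSin_pos hθ₀ hcrit)
  have hrlim : Tendsto (fun a => genSin κ ((1 - t) * θ' a) / genSin κ (θ' a)) u (𝓝 r) :=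
    (((continuous_genSin κ).tendsto _).comp (hθlim.const_mul _)).div
      (((continuous_genSin κ).tendsto _).comp hθlim) (genSin_pos hθ₀ hcrit).ne'
  -- In logarithmic form the contraction inequality is an upper bound for the entropy at time `t`,
  -- ready for lower semicontinuity.
  have hclim : Tendsto (fun a => a.2.1.2 - N * Real.log (genSin κ ((1 - t) * θ' a) /
      genSin κ (θ' a))) u (𝓝 (e - N * Real.log r)) :=
    helim.sub (((Real.continuousAt_log hr₀.ne').tendsto.comp hrlim).const_mul N)
  obtain ⟨hf, hle⟩ := entReal_le_of_tendsto (hμ' t) (fun a => hMf _) hMu hD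
    (hμD.mono fun a ha => ha t) hclim (by
      filter_upwards [hfe, hineq t ht] with a h1 h2
      refine ⟨h1 t ht, ?_⟩
      have h3 := Real.log_le_log (mul_pos h2.1 (Real.exp_pos _)) h2.2
      rw [Real.log_mul h2.1.ne' (Real.exp_ne_zero _), Real.log_exp, Real.log_exp,
        le_div_iff₀ hN, add_mul, div_mul_cancel₀ _ hN.ne'] at h3
      linarith)
  refine ⟨hf, ?_⟩
  rw [distortion_eq_ofReal hθ₀ hcrit, hent.entropicU_eq, hf.entropicU_eq,
    ← ENNReal.ofReal_mul hr₀.le]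
  refine ENNReal.ofReal_le_ofReal ?_
  change r * Real.exp (-e / N) ≤ _
  rw [← Real.exp_log hr₀, ← Real.exp_add]
  refine Real.exp_le_exp.2 ?_
  rw [le_div_iff₀ hN, add_mul, div_mul_cancel₀ _ hN.ne']
  linarith

end StabilityTheorem

/-! ## Transfer along isomorphic embeddings -/

section Transfer

open CausalSpace LorentzianPreLengthSpace

variable {X Y : Type*} [MetricSpace X] [MeasurableSpace X] [BorelSpace X]
  [LorentzianPreLengthSpace X] [MetricSpace Y] [MeasurableSpace Y] [BorelSpace Y]
  [LorentzianPreLengthSpace Y] {ι : X → Y}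

theorem Lorentz.IsIsomorphicEmbedding.isSigmaCompact_range (hι : IsIsomorphicEmbedding ι) :
    IsSigmaCompact (range ι) := by
  rw [← image_univ]
  exact isSigmaCompact_univ.image hι.isEmbedding.continuous

/-- The range need not be closed, but it is Borel: a proper space is σ-compact, and so is its
continuous image. -/
theorem Lorentz.IsIsomorphicEmbedding.measurableEmbedding (hι : IsIsomorphicEmbedding ι) :
    MeasurableEmbedding ι := by
  refine hι.isEmbedding.measurableEmbedding ?_
  obtain ⟨K, hK, hKι⟩ := hι.isSigmaCompact_range
  rw [← hKι]
  exact MeasurableSet.iUnion fun n => (hK n).measurableSet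

theorem Lorentz.IsIsomorphicEmbedding.chron_iff (hι : IsIsomorphicEmbedding ι) (x y : X) :
    chron x y ↔ chron (ι x) (ι y) := by
  rw [← tau_pos_iff, ← tau_pos_iff, hι.tau_eq]

theorem MeasurableEmbedding.map_injective_measure {X Y : Type*} [MeasurableSpace X]
    [MeasurableSpace Y] {ι : X → Y} (hι : MeasurableEmbedding ι) {μ ν : Measure X}
    (h : μ.map ι = ν.map ι) : μ = ν := by
  rw [← hι.comap_map μ, h, hι.comap_map]

theorem MeasurableEmbedding.exists_map_eq {X Y : Type*} [MeasurableSpace X]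
    [MeasurableSpace Y] {ι : X → Y} (hι : MeasurableEmbedding ι) {ν : Measure Y}
    (h : ν (range ι)ᶜ = 0) : (ν.comap ι).map ι = ν := by
  rw [hι.map_comap, Measure.restrict_eq_self_of_ae_mem]
  exact h

theorem exists_probabilityMeasure_map_eq {X Y : Type*} [MeasurableSpace X]
    [MeasurableSpace Y] {ι : X → Y} (hι : MeasurableEmbedding ι) (ν : ProbabilityMeasure Y)
    (h : (ν : Measure Y) (range ι)ᶜ = 0) :
    ∃ μ : ProbabilityMeasure X, (μ : Measure X).map ι = ν := by
  have h1 := hι.exists_map_eq h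
  refine ⟨⟨(ν : Measure Y).comap ι, ?_⟩, h1⟩
  have : IsProbabilityMeasure (((ν : Measure Y).comap ι).map ι) := by rw [h1]; infer_instance
  exact Measure.isProbabilityMeasure_of_map ι

theorem entropy_map {X Y : Type*} [MeasurableSpace X] [MeasurableSpace Y] {ι : X → Y}
    (hι : MeasurableEmbedding ι) (μ m : Measure X) [SigmaFinite μ] [SigmaFinite m] :
    entropy (μ.map ι) (m.map ι) = entropy μ m := by
  have h1 : (μ.map ι ≪ m.map ι) ↔ μ ≪ m := by
    refine ⟨fun h => ?_, hι.absolutelyContinuous_map⟩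
    refine Measure.AbsolutelyContinuous.mk fun s hs hs0 => ?_
    have h2 : (m.map ι) (ι '' s) = 0 := by
      rwa [hι.map_apply, hι.injective.preimage_image]
    have h3 := h h2
    rwa [hι.map_apply, hι.injective.preimage_image] at h3
  have h2 : ∀ F : ℝ → ℝ≥0∞, ∫⁻ y, F (density (μ.map ι) (m.map ι) y) ∂(m.map ι) =
      ∫⁻ x, F (density μ m x) ∂m := by
    intro F
    rw [hι.lintegral_map]
    refine lintegral_congr_ae ?_
    filter_upwards [hι.rnDeriv_map μ m] with x hx
    rw [density, hx, density]
  have h3 := h2 fun r => ENNReal.ofReal (r * Real.log r)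
  have h4 := h2 fun r => ENNReal.ofReal (-(r * Real.log r))
  unfold entropy
  rw [h4, h3]
  split_ifs with ha hb hb
  · rfl
  · exact absurd ⟨h1.1 ha.1, ha.2⟩ hb
  · exact absurd ⟨h1.2 hb.1, hb.2⟩ ha
  · rfl

theorem ellP_map (hι : IsIsomorphicEmbedding ι) (p : ℝ) (μ ν : Measure X) :
    ellP p (μ.map ι) (ν.map ι) = ellP p μ ν := by
  have hm := hι.measurableEmbedding
  have hmm : MeasurableEmbedding (Prod.map ι ι) := hm.prodMap hm
  have hcost : ∀ π : Measure (X × X), timeCost p (π.map (Prod.map ι ι)) = timeCost p π := by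
    intro π
    rw [timeCost, hmm.lintegral_map]
    simp only [Prod.map_fst, Prod.map_snd, hι.tau_eq]
    rfl
  have hfst : ∀ π : Measure (X × X),
      (π.map (Prod.map ι ι)).map Prod.fst = (π.map Prod.fst).map ι := fun π => by
    rw [Measure.map_map measurable_fst hmm.measurable, Measure.map_map hm.measurable measurable_fst]
    rfl
  have hsnd : ∀ π : Measure (X × X),
      (π.map (Prod.map ι ι)).map Prod.snd = (π.map Prod.snd).map ι := fun π => by
    rw [Measure.map_map measurable_snd hmm.measurable, Measure.map_map hm.measurable measurable_snd]
    rfl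
  have hcaus : ∀ π : Measure (X × X), (∀ᵐ z ∂(π.map (Prod.map ι ι)), causal z.1 z.2) ↔
      ∀ᵐ z ∂π, causal z.1 z.2 := fun π => by
    rw [hmm.ae_map_iff]
    simp only [Prod.map_fst, Prod.map_snd, ← hι.causal_iff]
  refine le_antisymm (iSup₂_le fun π hπ => ?_) (iSup₂_le fun π hπ => ?_)
  -- Both marginals are carried by the range, so every ambient coupling comes from a coupling on
  -- `X`.
  · have hrange : π (range (Prod.map ι ι))ᶜ = 0 := by
      have h0 : ∀ κ : Measure X, ∀ᵐ y ∂(κ.map ι), y ∈ range ι := fun κ => by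
        rw [hm.ae_map_iff]
        exact Eventually.of_forall fun x => mem_range_self x
      have h1 : ∀ᵐ z ∂π, z.1 ∈ range ι := by
        refine (ae_map_iff measurable_fst.aemeasurable hm.measurableSet_range).1 ?_
        rw [hπ.map_fst]
        exact h0 μ
      have h2 : ∀ᵐ z ∂π, z.2 ∈ range ι := by
        refine (ae_map_iff measurable_snd.aemeasurable hm.measurableSet_range).1 ?_
        rw [hπ.map_snd]
        exact h0 ν
      have : ∀ᵐ z ∂π, z ∈ range (Prod.map ι ι) := by
        filter_upwards [h1, h2] with z hz1 hz2
        rw [range_prodMap]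
        exact ⟨hz1, hz2⟩
      exact this
    obtain ⟨π', rfl⟩ : ∃ π' : Measure (X × X), π'.map (Prod.map ι ι) = π :=
      ⟨_, hmm.exists_map_eq hrange⟩
    have hπ' : IsCausalCoupling π' μ ν :=
      ⟨hm.map_injective_measure (by rw [← hfst, hπ.map_fst]),
        hm.map_injective_measure (by rw [← hsnd, hπ.map_snd]), (hcaus π').1 hπ.ae_causal⟩
    change ((timeCost p (π'.map (Prod.map ι ι)) ^ (1 / p) : ℝ≥0∞) : EReal) ≤ _
    rw [hcost]
    exact le_ellP hπ'
  · have hπ' : IsCausalCoupling (π.map (Prod.map ι ι)) (μ.map ι) (ν.map ι) :=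
      ⟨by rw [hfst, hπ.map_fst], by rw [hsnd, hπ.map_snd], (hcaus π).2 hπ.ae_causal⟩
    change ((timeCost p π ^ (1 / p) : ℝ≥0∞) : EReal) ≤ _
    rw [← hcost]
    exact le_ellP hπ'

theorem isEllPGeodesic_iff_of_map (hι : IsIsomorphicEmbedding ι) {p : ℝ}
    {μ : Icc (0 : ℝ) 1 → ProbabilityMeasure X} {μ' : Icc (0 : ℝ) 1 → ProbabilityMeasure Y}
    (h : ∀ t, (μ t : Measure X).map ι = μ' t) : IsEllPGeodesic p μ ↔ IsEllPGeodesic p μ' := by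
  simp only [IsEllPGeodesic, ← h, ellP_map hι]

theorem tauNorm_map (hι : IsIsomorphicEmbedding ι) (μ : Measure X) (x : X) :
    tauNorm (μ.map ι) (ι x) = tauNorm μ x := by
  simp only [tauNorm, hι.measurableEmbedding.lintegral_map, hι.tau_eq]

theorem entropicU_map {X Y : Type*} [MeasurableSpace X] [MeasurableSpace Y] {ι : X → Y}
    (hι : MeasurableEmbedding ι) (N : ℝ) (μ m : Measure X) [SigmaFinite μ] [SigmaFinite m] :
    entropicU N (μ.map ι) (m.map ι) = entropicU N μ m := by
  rw [entropicU, entropy_map hι, entropicU]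

theorem Lorentz.TMCP.contractsOn (hι : IsIsomorphicEmbedding ι) {p K N : ℝ} {m : Measure X}
    [SigmaFinite m] (h : TMCP p K N m) : ContractsOn p K N (m.map ι) (range ι) := by
  have hm := hι.measurableEmbedding
  rintro C ν _ ⟨⟨x, rfl⟩, ⟨A, hA, hAι, hνA⟩, -, hent, hchron⟩
  obtain ⟨μ₀, hμ₀⟩ := exists_probabilityMeasure_map_eq hm ν
    (measure_mono_null (compl_subset_compl.2 hAι) hνA)
  have hsupp : IsCompact (μ₀ : Measure X).support := by
    have hcomp : IsCompact (ι ⁻¹' A) := (hι.isEmbedding.isInducing.isCompact_preimage_iff hAι).2 hA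
    refine hcomp.of_isClosed_subset Measure.isClosed_support
      (Measure.support_subset_of_isClosed hcomp.isClosed ?_)
    have : (μ₀ : Measure X).map ι Aᶜ = 0 := by rw [hμ₀]; exact hνA
    rw [hm.map_apply] at this
    exact this
  have hent' : entropy (μ₀ : Measure X) m = (entReal (ν : Measure Y) (m.map ι) : EReal) := by
    rw [← entropy_map hm, hμ₀, hent.entropy_eq]
  have hchron' : ∀ᵐ z ∂(μ₀ : Measure X), chron z x := by
    rw [← hμ₀, hm.ae_map_iff] at hchron
    exact hchron.mono fun z hz => (hι.chron_iff _ _).2 hz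
  obtain ⟨μ, h1, h2, h3, h4⟩ := h μ₀ hsupp (by rw [hent']; exact EReal.coe_ne_top _)
    (by rw [hent']; exact EReal.coe_ne_bot _) x hchron'
  let μ' : Icc (0 : ℝ) 1 → ProbabilityMeasure Y := fun t =>
    (μ t).map hm.measurable.aemeasurable
  have hμ' : ∀ t, (μ t : Measure X).map ι = μ' t := fun t => rfl
  refine ⟨μ', (isEllPGeodesic_iff_of_map hι hμ').1 h1, ?_, ?_, fun t ht => ?_⟩
  · refine Subtype.ext ?_
    change (μ 0 : Measure X).map ι = ν
    rw [h2, hμ₀]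
  · rw [← hμ', h3, Measure.map_dirac' hm.measurable]
  · rw [← hμ', ← hμ₀, tauNorm_map hι, entropicU_map hm, entropicU_map hm]
    exact h4 t ht

theorem isFiniteMeasureOnCompacts_of_integrable {M : Measure Y}
    (h : ∀ φ : Y → ℝ, Continuous φ → HasCompactSupport φ → Integrable φ M) :
    IsFiniteMeasureOnCompacts M := by
  refine ⟨fun K hK => ?_⟩
  obtain ⟨χ, hχ1, -, hχc, hχ01⟩ := exists_continuous_one_zero_of_isCompact hK isClosed_empty
    (disjoint_empty K)
  have hi := (h χ χ.continuous hχc).lintegral_lt_top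
  refine lt_of_le_of_lt ?_ hi
  rw [← lintegral_indicator_one hK.measurableSet]
  refine lintegral_mono fun x => ?_
  by_cases hx : x ∈ K
  · have : χ x = 1 := hχ1 hx
    simp [hx, this]
  · simp [hx]

theorem sigmaFinite_of_isReferenceMeasure {m : Measure X} (hm : IsReferenceMeasure m) :
    SigmaFinite m := by
  have : IsFiniteMeasureOnCompacts m := ⟨fun C hC => hm.lt_top_of_isCompact C hC⟩
  infer_instance

end Transfer

theorem mainTheorem2
    {X : ℕ∞ → Type*} [∀ j, MetricSpace (X j)] [∀ j, LorentzianPreLengthSpace (X j)]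
    [∀ j, MeasurableSpace (X j)] [∀ j, BorelSpace (X j)]
    (m : ∀ j, Measure (X j)) (hm : ∀ j, IsReferenceMeasure (m j))
    (hgeo : ∀ j, IsGeodesicSpace (X j))
    {Xbar : Type*} [MetricSpace Xbar] [LorentzianPreLengthSpace Xbar]
    [MeasurableSpace Xbar] [BorelSpace Xbar]
    (hclosed : LocallyCausallyClosed Xbar) (hhyp : KGloballyHyperbolic Xbar)
    (hgeobar : IsGeodesicSpace Xbar)
    (htaufin : ∀ x y : Xbar, LorentzianPreLengthSpace.tau x y ≠ ∞)
    (htaucont : Continuous fun z : Xbar × Xbar => LorentzianPreLengthSpace.tau z.1 z.2)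
    (ι : ∀ j, X j → Xbar) (hι : ∀ j, IsIsomorphicEmbedding (ι j))
    (hconv : WeaklyConverges fun j => (m j).map (ι j))
    (p K N : ℝ) (hp₀ : 0 < p) (hp₁ : p < 1) (hN : 0 < N)
    (hTMCP : ∀ n : ℕ, TMCP p K N (m n)) :
    TMCP p K N (m ⊤) := by
  have hemb : ∀ j, MeasurableEmbedding (ι j) := fun j => (hι j).measurableEmbedding
  have hsf : ∀ j, SigmaFinite (m j) := fun j => sigmaFinite_of_isReferenceMeasure (hm j)
  -- Local finiteness of the push-forwards comes from the integrability required in the convergence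
  -- hypothesis: preimages of compact sets under `ι j` need not be compact.
  have hfin : ∀ j, IsFiniteMeasureOnCompacts ((m j).map (ι j)) := fun j =>
    isFiniteMeasureOnCompacts_of_integrable fun φ hφ hφc => (hconv φ hφ hφc).1 j
  have hrange : ∀ j, (m j).map (ι j) (range (ι j))ᶜ = 0 := fun j => by
    rw [(hemb j).map_apply, preimage_compl, preimage_range, compl_univ, measure_empty]
  intro μ₀ hsupp htop hbot x₁ hchron
  have hent : FiniteEntropy ((μ₀ : Measure (X ⊤)).map (ι ⊤)) ((m ⊤).map (ι ⊤)) := by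
    refine finiteEntropy_of_ne_top_of_ne_bot ?_ ?_ <;> rwa [entropy_map (hemb ⊤)]
  let ν : ProbabilityMeasure Xbar := μ₀.map (hemb ⊤).measurable.aemeasurable
  have hν : (ν : Measure Xbar) = (μ₀ : Measure (X ⊤)).map (ι ⊤) := rfl
  have hνC : (ν : Measure Xbar) (ι ⊤ '' (μ₀ : Measure (X ⊤)).support)ᶜ = 0 := by
    rw [hν, (hemb ⊤).map_apply, preimage_compl, (hemb ⊤).injective.preimage_image]
    exact Measure.measure_compl_support
  have hnhds : ∀ U ∈ 𝓝 (ι ⊤ x₁), 0 < (m ⊤).map (ι ⊤) U := by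
    intro U hU
    rw [(hemb ⊤).map_apply]
    have hx : x₁ ∈ (m ⊤).support := by rw [(hm ⊤).support_eq]; exact mem_univ _
    exact (Measure.mem_support_iff_forall x₁).1 hx _
      ((hι ⊤).isEmbedding.continuous.continuousAt.preimage_mem_nhds hU)
  obtain ⟨μ', h1, h2, h3, h4⟩ := exists_contraction_of_tendsto
    (isClosed_causal hhyp.isCompact_diamond) hhyp.isCompact_diamond htaucont htaufin hp₀ hp₁ hN
    (fun n : ℕ => hfin n) (fun n : ℕ => (hι n).isSigmaCompact_range) (fun n : ℕ => hrange n)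
    (fun φ hφ hφc => (hconv φ hφ hφc).2) (fun n : ℕ => (hTMCP n).contractsOn (hι n)) (ν := ν)
    (hsupp.image (hι ⊤).isEmbedding.continuous) hνC hent hnhds
    (((hemb ⊤).ae_map_iff).2 (hchron.mono fun z hz => ((hι ⊤).chron_iff _ _).1 hz))
  have hμ : ∀ t, ∃ μ : ProbabilityMeasure (X ⊤), (μ : Measure (X ⊤)).map (ι ⊤) = μ' t := by
    intro t
    refine exists_probabilityMeasure_map_eq (hemb ⊤) _ ?_
    rcases (show t ≤ 1 from t.2.2).lt_or_eq with ht | rfl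
    -- Absolute continuity with respect to the limit reference measure forces the limit back onto
    -- the embedded space.
    · exact (h4 t ht).1.1 (hrange ⊤)
    · rw [h3, Measure.dirac_apply' _ (hemb ⊤).measurableSet_range.compl]
      simp
  choose μ hμ using hμ
  refine ⟨μ, (isEllPGeodesic_iff_of_map (hι ⊤) hμ).2 h1, ?_, ?_, fun t ht => ?_⟩
  · refine Subtype.ext ((hemb ⊤).map_injective_measure ?_)
    change (μ 0 : Measure (X ⊤)).map (ι ⊤) = _
    rw [hμ, h2]
    rfl
  · refine (hemb ⊤).map_injective_measure ?_
    rw [hμ, h3, Measure.map_dirac' (hemb ⊤).measurable]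
  · have := (h4 t ht).2
    rwa [← hμ, hν, tauNorm_map (hι ⊤), entropicU_map (hemb ⊤), entropicU_map (hemb ⊤)] at this
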